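/- **Definitions.** Let $S$ be a nonempty finite set and $\mathrm{wt}:S\to\mathbb R\setminus\{0\}$ a function with $\sum_{s\in S}\mathrm{wt}(s)=0$. The pair $\Xi_F=(S,\mathrm{wt})$ is called a *full passport*, and $|\Xi_F|:=|S|$. A *labeled weighted bi-colored plane tree* of passport $\Xi_F$ is a plane tree whose vertices are partitioned into black and white ones such that every edge joins a black vertex to a white vertex, with a positive real weight on every edge and a labeling of its vertices by $S$ in which each $s\in S$ labels exactly one vertex, such that for every vertex $v$ with label $s$ the sum of the weights of the edges at $v$ equals $\mathrm{wt}(s)$ if $v$ is black and $-\mathrm{wt}(s)$ if $v$ is white. Here a plane tree is a finite tree together with, at each vertex, a cyclic order of the edges at that vertex (their anticlockwise order around the vertex in the plane). Two such trees are isomorphic if there is a graph isomorphism between them that preserves the cyclic orders, the colors, the edge weights and the labels; $\mathrm{Tree}(\Xi_F)$ denotes the set of isomorphism classes. Let $\mathfrak P(\Xi_F)$ be the set of all partitions $p=\{S_1,\dots,S_n\}$ of $S$ into nonempty blocks with $\sum_{s\in S_i}\mathrm{wt}(s)=0$ for every $i$; put $|p|:=n$ and $X(p):=\prod_{i=1}^{n}(|S_i|-1)!$.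 The passport $\Xi_F$ is *non-decomposable* if $\{S\}$ is the only element of $\mathfrak P(\Xi_F)$. **Theorem (Kochetkov's formula).** For every full passport $\Xi_F$, the set $\mathrm{Tree}(\Xi_F)$ is finite and $$|\mathrm{Tree}(\Xi_F)|=\sum_{p\in\mathfrak P(\Xi_F)}(-1)^{|p|-1}\,(|\Xi_F|-1)^{|p|-2}\,X(p).$$ In particular, if $\Xi_F$ is non-decomposable, then $$|\mathrm{Tree}(\Xi_F)|=(|\Xi_F|-2)!.$$ -/

import Mathlib

open scoped Nat

universe u

/-- A passport `(S, λ, wt)` on the index set `S`: a nonempty finite set `S`, a multiplicity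
function `λ : S → ℤ₊` and a weight function `wt : S → ℝ \ {0}` with `∑ λ(s) wt(s) = 0`. -/
structure Passport (S : Type u) [Fintype S] where
  nonempty : Nonempty S
  mult : S → ℕ
  mult_pos : ∀ s, 0 < mult s
  wt : S → ℝ
  wt_ne_zero : ∀ s, wt s ≠ 0
  sum_eq_zero : ∑ s, (mult s : ℝ) * wt s = 0

/-- A weighted bi-colored plane tree with vertex type `V`.

The planar structure is the rotation system of the tree: at every vertex `v` a cyclic
permutation `next v` of the edges at `v`, giving the anticlockwise next edge around `v`.
As the graph is simple, an edge at `v` is recorded by its other endpoint. -/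
structure WBPTree (V : Type u) where
  graph : SimpleGraph V
  isTree : graph.IsTree
  /-- the black vertices; the others are white -/
  black : Set V
  bicolored : ∀ v w, graph.Adj v w → (v ∈ black ↔ w ∉ black)
  next : ∀ v, Equiv.Perm (graph.neighborSet v)
  /-- `next v` is one cycle through all the edges at `v` -/
  next_cyclic : ∀ v (a b : graph.neighborSet v), (next v).SameCycle a b
  edgeWeight : graph.edgeSet → ℝ
  edgeWeight_pos : ∀ e, 0 < edgeWeight e

namespace WBPTree

variable {V : Type u} (T : WBPTree V)

/-- The sum of the weights of the edges at `v`. -/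
noncomputable def edgeSum (v : V) : ℝ :=
  ∑ᶠ (e : T.graph.edgeSet) (_ : v ∈ (e : Sym2 V)), T.edgeWeight e

open Classical in
/-- The weight of a vertex: the sum of the weights of its edges, with sign `+` at black and
sign `-` at white vertices. -/
noncomputable def vertexWeight (v : V) : ℝ :=
  if v ∈ T.black then T.edgeSum v else -T.edgeSum v

end WBPTree

/-- A labeled weighted bi-colored plane tree of passport `Ξ`. -/
structure LWBPTree {S : Type u} [Fintype S] (Ξ : Passport S) where
  V : Type u
  finite : Finite V
  tree : WBPTree V
  lab : V → S
  lab_surjective : Function.Surjective lab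
  wt_lab : ∀ v, Ξ.wt (lab v) = tree.vertexWeight v
  card_fiber : ∀ s, Nat.card {v : V // lab v = s} = Ξ.mult s

namespace LWBPTree

variable {S : Type u} [Fintype S] {Ξ : Passport S}

/-- Isomorphism of labeled weighted bi-colored plane trees: a graph isomorphism that preserves
the colors, the cyclic order of the edges around every vertex (hence the orientation of the
plane), the weights of the edges and the labels of the vertices. -/
def Isomorphic (T₁ T₂ : LWBPTree Ξ) : Prop :=
  ∃ f : T₁.tree.graph ≃g T₂.tree.graph,
    (∀ v, f v ∈ T₂.tree.black ↔ v ∈ T₁.tree.black) ∧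
    (∀ v (a : T₁.tree.graph.neighborSet v),
      f.mapNeighborSet v (T₁.tree.next v a) = T₂.tree.next (f v) (f.mapNeighborSet v a)) ∧
    (∀ e, T₂.tree.edgeWeight (f.mapEdgeSet e) = T₁.tree.edgeWeight e) ∧
    (∀ v, T₂.lab (f v) = T₁.lab v)

theorem Isomorphic.refl (T : LWBPTree Ξ) : T.Isomorphic T := by
  refine ⟨SimpleGraph.Iso.refl, fun v => Iff.rfl, fun v a => rfl, fun e => ?_, fun v => rfl⟩
  congr 1
  apply Subtype.ext
  exact congrFun Sym2.map_id e.1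

theorem Isomorphic.trans {T₁ T₂ T₃ : LWBPTree Ξ} (h : T₁.Isomorphic T₂)
    (h' : T₂.Isomorphic T₃) : T₁.Isomorphic T₃ := by
  obtain ⟨f, hb, hn, hw, hl⟩ := h
  obtain ⟨g, hb', hn', hw', hl'⟩ := h'
  refine ⟨f.trans g, fun v => (hb' _).trans (hb v), fun v a => ?_, fun e => ?_,
    fun v => (hl' _).trans (hl v)⟩
  · have h1 := hn' (f v) (f.mapNeighborSet v a)
    rw [← hn v a] at h1
    exact h1
  · rw [← hw e, ← hw' (f.mapEdgeSet e)]
    congr 1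
    apply Subtype.ext
    exact (Sym2.map_map (g := g) (f := f) e.1).symm

theorem Isomorphic.symm {T₁ T₂ : LWBPTree Ξ} (h : T₁.Isomorphic T₂) : T₂.Isomorphic T₁ := by
  obtain ⟨f, hb, hn, hw, hl⟩ := h
  refine ⟨f.symm, fun v => ?_, fun v a => ?_, fun e => ?_, fun v => ?_⟩
  · rw [← hb, RelIso.apply_symm_apply]
  · obtain ⟨v, rfl⟩ := f.surjective v
    obtain ⟨a, rfl⟩ := (f.mapNeighborSet v).surjective a
    rw [← hn v a]
    have key : ∀ (w : T₁.V) (hw : w = v) (b : T₁.tree.graph.neighborSet v)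
        (c : T₁.tree.graph.neighborSet w), (b : T₁.V) = c →
        ((T₁.tree.next v b : T₁.tree.graph.neighborSet v) : T₁.V) = T₁.tree.next w c := by
      rintro w rfl b c hbc
      rw [Subtype.ext hbc]
    apply Subtype.ext
    refine Eq.trans ?_ (key _ (f.symm_apply_apply v) a _ ?_)
    · exact f.symm_apply_apply _
    · exact (f.symm_apply_apply _).symm
  · obtain ⟨e, rfl⟩ := f.mapEdgeSet.surjective e
    rw [hw]
    congr 1
    exact f.mapEdgeSet.symm_apply_apply e
  · rw [← hl, RelIso.apply_symm_apply]

instance setoid (Ξ : Passport S) : Setoid (LWBPTree Ξ) where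
  r := Isomorphic
  iseqv := ⟨Isomorphic.refl, Isomorphic.symm, Isomorphic.trans⟩

end LWBPTree

namespace Passport

variable {S : Type u} [Fintype S] (Ξ : Passport S)

/-- The set of isomorphism classes of labeled weighted bi-colored plane trees of passport `Ξ`. -/
def Trees : Type (u + 1) := Quotient (LWBPTree.setoid Ξ)

/-- A passport is full if all multiplicities are `1`. -/
def IsFull : Prop := ∀ s, Ξ.mult s = 1

/-- The total number of vertices `|Ξ|`. -/
def size : ℕ := ∑ s, Ξ.mult s

variable [DecidableEq S]

open Classical in
/-- The partitions of (the index set of) a passport into subpassports, that is, into nonempty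
blocks whose weights sum to zero. -/
noncomputable def partitions : Finset (Finpartition (Finset.univ : Finset S)) :=
  Finset.univ.filter fun p => ∀ B ∈ p.parts, ∑ s ∈ B, (Ξ.mult s : ℝ) * Ξ.wt s = 0

/-- The only partition of the passport is the trivial one, with the single block `S`. -/
def IsNonDecomposable : Prop := ∀ p ∈ Ξ.partitions, p.parts = {Finset.univ}

end Passport

/-- `X(p) = ∏ (|Sᵢ| - 1)!` over the blocks `Sᵢ` of `p`. -/
def partitionX {S : Type u} [Fintype S] [DecidableEq S]
    (p : Finpartition (Finset.univ : Finset S)) : ℕ :=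
  ∏ B ∈ p.parts, (B.card - 1)!

/-!
A labeled weighted plane tree of a full passport is a tree `G` on the label set `S` together with a
rotation system; its edge weights, signed by the color of the source, form the unique flow on `G`
with net outflow `wt s` at every vertex `s`. Hence the number of isomorphism classes is the sum of
`∏ (deg v - 1)!` over the trees that carry a flow running from black to white vertices
(`Passport.IsFull.treesEquiv`, `card_planeFlowTree`).

Let `signedSeries wt σ` be the generating series, in the ring of functions of finite subsets of `S`
under subset convolution, of such trees on subsets `A` of `S` with a planted root of sign `σ` whose
own weight condition is dropped. Deleting the first edge at the root gives `t = a + t u` and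
`u = b + u t` with `t`, `u` the series for black and white roots, `a`, `b` the indicators of the
black and white vertices, and with only the negative part of `u` and the positive part of `t` (with
respect to the sign of the total weight) in the products (`signedSeries_eq`). On the full set, where
the total weight is zero, the condition at the root is automatic, so `t` counts trees with a marked
edge (`signedSeries_univ`).

The recursion is solved by a Wiener-Hopf factorization. The series of linear orders
`1 / (1 - singles)` is the exponential of the series `cyc` of cyclic orders; splitting `cyc` by the
sign of the weight factors `1 - singles` as `(1 - P)(1 - N) / L`, where `L` is the exponential of the
zero-weight part `X` of `cyc` (`wiener_hopf`). If every element `s` of a set is replaced by `s` times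
`L`, which is a ring homomorphism, the positive part of `t` becomes `P`, the negative part of `u`
becomes `N`, and the zero-weight part of `t` becomes `L - 1` (`dress_eq_walk`, `cut_zero_walk`).
Lagrange inversion of this substitution gives, on a set of `n` elements of total weight zero,
`(1 - n) t = exp ((1 - n) X)` (`lagrange_inversion`), and the coefficient on the right is the sum over
zero-sum partitions `p` of `(1 - n) ^ |p| * X(p)`.
-/

/-! ### The ring of set series -/

/-- Functions on the finite subsets of `S`, as a ring under subset convolution: the multilinear part
of the power series in commuting variables indexed by `S`, with product
`(f * g)(A) = ∑ f(B) g(A \ B)` over the subsets `B` of `A`. -/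
def SetSeries (S : Type u) : Type u := Finset S → ℚ

namespace SetSeries

section Linear

variable {S : Type u}

instance : AddCommGroup (SetSeries S) := inferInstanceAs (AddCommGroup (Finset S → ℚ))

instance : Module ℚ (SetSeries S) := inferInstanceAs (Module ℚ (Finset S → ℚ))

@[ext] theorem ext {f g : SetSeries S} (h : ∀ A, f A = g A) : f = g := funext h

@[simp] theorem zero_apply (A : Finset S) : (0 : SetSeries S) A = 0 := rfl
@[simp] theorem add_apply (f g : SetSeries S) (A : Finset S) : (f + g) A = f A + g A := rfl
@[simp] theorem sub_apply (f g : SetSeries S) (A : Finset S) : (f - g) A = f A - g A := rfl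
@[simp] theorem neg_apply (f : SetSeries S) (A : Finset S) : (-f) A = -f A := rfl
@[simp] theorem smul_apply (z : ℚ) (f : SetSeries S) (A : Finset S) : (z • f) A = z * f A := rfl

@[simp] theorem sum_apply {ι : Type*} (s : Finset ι) (f : ι → SetSeries S) (A : Finset S) :
    (∑ i ∈ s, f i) A = ∑ i ∈ s, f i A := Finset.sum_apply (M := fun _ : Finset S => ℚ) A s f

/-- The degree derivation `f ↦ |A| f(A)`. -/
def euler (f : SetSeries S) : SetSeries S := fun A => (A.card : ℚ) * f A

theorem euler_apply (f : SetSeries S) (A : Finset S) : euler f A = A.card * f A := rfl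

theorem euler_add (f g : SetSeries S) : euler (f + g) = euler f + euler g := by
  ext A; simp [euler_apply, mul_add]

theorem euler_smul (z : ℚ) (f : SetSeries S) : euler (z • f) = z • euler f := by
  ext A; simp [euler_apply]; ring

end Linear

section Ring

variable {S : Type u} [DecidableEq S]

instance : Mul (SetSeries S) := ⟨fun f g A => ∑ B ∈ A.powerset, f B * g (A \ B)⟩

theorem mul_apply (f g : SetSeries S) (A : Finset S) :
    (f * g) A = ∑ B ∈ A.powerset, f B * g (A \ B) := rfl

instance : One (SetSeries S) := ⟨fun A => if A = ∅ then 1 else 0⟩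

theorem one_apply (A : Finset S) : (1 : SetSeries S) A = if A = ∅ then 1 else 0 := rfl

protected theorem mul_comm (f g : SetSeries S) : f * g = g * f := by
  ext A
  rw [mul_apply, mul_apply]
  refine Finset.sum_bij' (fun B _ => A \ B) (fun B _ => A \ B) ?_ ?_ ?_ ?_ ?_
  · intro B _; simp
  · intro B _; simp
  · intro B hB; simpa using hB
  · intro B hB; simpa using hB
  · intro B hB
    rw [Finset.sdiff_sdiff_eq_self (Finset.mem_powerset.1 hB), mul_comm]

protected theorem mul_assoc (f g h : SetSeries S) : f * g * h = f * (g * h) := by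
  ext A
  simp only [mul_apply, Finset.sum_mul, Finset.mul_sum]
  rw [Finset.sum_sigma', Finset.sum_sigma']
  refine Finset.sum_bij' (fun x _ => ⟨x.2, x.1 \ x.2⟩) (fun x _ => ⟨x.1 ∪ x.2, x.1⟩) ?_ ?_ ?_ ?_ ?_
  · rintro ⟨C, B⟩ hx
    simp only [Finset.mem_sigma, Finset.mem_powerset] at hx ⊢
    exact ⟨hx.2.trans hx.1, Finset.sdiff_subset_sdiff hx.1 subset_rfl⟩
  · rintro ⟨B, D⟩ hx
    simp only [Finset.mem_sigma, Finset.mem_powerset] at hx ⊢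
    exact ⟨Finset.union_subset hx.1 (hx.2.trans Finset.sdiff_subset), Finset.subset_union_left⟩
  · rintro ⟨C, B⟩ hx
    simp only [Finset.mem_sigma, Finset.mem_powerset] at hx
    simp [Finset.union_eq_right.2 hx.2]
  · rintro ⟨B, D⟩ hx
    simp only [Finset.mem_sigma, Finset.mem_powerset] at hx
    have : Disjoint B D := Finset.disjoint_of_subset_right hx.2 Finset.disjoint_sdiff
    simp [Finset.union_sdiff_cancel_left this]
  · rintro ⟨C, B⟩ hx
    simp only [Finset.mem_sigma, Finset.mem_powerset] at hx
    have : (A \ B) \ (C \ B) = A \ C := by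
      ext x
      have := @hx.2 x
      simp only [Finset.mem_sdiff]; tauto
    rw [this, mul_assoc]

protected theorem one_mul (f : SetSeries S) : 1 * f = f := by
  ext A
  rw [mul_apply, Finset.sum_eq_single ∅]
  · simp [one_apply]
  · intro B _ hB; simp [one_apply, hB]
  · simp

protected theorem mul_add (f g h : SetSeries S) : f * (g + h) = f * g + f * h := by
  ext A
  simp [mul_apply, mul_add, Finset.sum_add_distrib]

instance : CommRing (SetSeries S) where
  __ := (inferInstance : AddCommGroup (SetSeries S))
  mul_assoc := SetSeries.mul_assoc
  one_mul := SetSeries.one_mul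
  mul_one f := by rw [SetSeries.mul_comm, SetSeries.one_mul]
  left_distrib := SetSeries.mul_add
  right_distrib f g h := by
    rw [SetSeries.mul_comm, SetSeries.mul_add, SetSeries.mul_comm h, SetSeries.mul_comm h]
  mul_comm := SetSeries.mul_comm
  zero_mul f := by ext A; simp [mul_apply]
  mul_zero f := by ext A; simp [mul_apply]

theorem mul_apply_empty (f g : SetSeries S) : (f * g) ∅ = f ∅ * g ∅ := by simp [mul_apply]

theorem smul_mul (z : ℚ) (f g : SetSeries S) : z • f * g = z • (f * g) := by
  ext A; simp [mul_apply, Finset.mul_sum, mul_assoc]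

theorem euler_mul (f g : SetSeries S) : euler (f * g) = euler f * g + f * euler g := by
  ext A
  simp only [euler_apply, mul_apply, add_apply, Finset.mul_sum]
  rw [← Finset.sum_add_distrib]
  refine Finset.sum_congr rfl fun B hB => ?_
  have : (A.card : ℚ) = B.card + (A \ B).card := by
    rw [← Nat.cast_add, add_comm, Finset.card_sdiff_add_card_eq_card (Finset.mem_powerset.1 hB)]
  rw [this]; ring

/-- A series is determined by its constant term and its logarithmic derivative. -/
theorem eq_of_euler_eq {f g k : SetSeries S} (h0 : f ∅ = g ∅) (hk : k ∅ = 0)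
    (hf : euler f = k * f) (hg : euler g = k * g) : f = g := by
  ext A
  induction A using Finset.strongInduction with
  | H A ih =>
    rcases A.eq_empty_or_nonempty with rfl | hA
    · exact h0
    have h1 : euler f A = euler g A := by
      rw [hf, hg, mul_apply, mul_apply]
      refine Finset.sum_congr rfl fun B hB => ?_
      rcases B.eq_empty_or_nonempty with rfl | hB'
      · simp [hk]
      · rw [ih _ (Finset.sdiff_ssubset (Finset.mem_powerset.1 hB) hB')]
    have h2 : (A.card : ℚ) ≠ 0 := by simpa using hA.ne_empty
    exact mul_left_cancel₀ h2 h1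

end Ring

section Exp

variable {S : Type u} [DecidableEq S] [Fintype S]

open Classical in
/-- The partitions of `A` into nonempty blocks, as sets of blocks. -/
noncomputable def blockSets (A : Finset S) : Finset (Finset (Finset S)) :=
  Finset.univ.filter fun P => ∅ ∉ P ∧ (P : Set (Finset S)).PairwiseDisjoint id ∧ P.sup id = A

theorem mem_blockSets {A : Finset S} {P : Finset (Finset S)} : P ∈ blockSets A ↔
    ∅ ∉ P ∧ (P : Set (Finset S)).PairwiseDisjoint id ∧ P.sup id = A := by
  simp [blockSets]

theorem blockSets_empty : blockSets (∅ : Finset S) = {∅} := by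
  ext P
  simp only [mem_blockSets, Finset.mem_singleton]
  constructor
  · rintro ⟨h1, -, h3⟩
    refine Finset.eq_empty_of_forall_notMem fun B hB => h1 ?_
    have h : B ≤ P.sup id := Finset.le_sup (f := id) hB
    rw [h3] at h
    rwa [Finset.subset_empty.1 h] at hB
  · rintro rfl; simp

/-- The exponential: the sum over the partitions of `A` of the product of `h` over the blocks. -/
noncomputable def setExp (h : SetSeries S) : SetSeries S := fun A => ∑ P ∈ blockSets A, ∏ B ∈ P, h B

theorem setExp_apply (h : SetSeries S) (A : Finset S) :
    setExp h A = ∑ P ∈ blockSets A, ∏ B ∈ P, h B := rfl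

@[simp] theorem setExp_apply_empty (h : SetSeries S) : setExp h ∅ = 1 := by
  rw [setExp_apply, blockSets_empty, Finset.sum_singleton]
  rfl

/-- The exponential differential equation: mark a block, weighted by its size. -/
theorem euler_setExp (h : SetSeries S) : euler (setExp h) = euler h * setExp h := by
  ext A
  have h1 : ∀ P ∈ blockSets A, (A.card : ℚ) * ∏ B ∈ P, h B =
      ∑ B ∈ P, B.card * h B * ∏ C ∈ P.erase B, h C := by
    intro P hP
    obtain ⟨-, hd, hA⟩ := mem_blockSets.1 hP
    have : A.card = ∑ B ∈ P, B.card := by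
      rw [← hA, Finset.sup_eq_biUnion]
      exact Finset.card_biUnion fun x hx y hy hxy => hd hx hy hxy
    rw [this, Nat.cast_sum, Finset.sum_mul]
    refine Finset.sum_congr rfl fun B hB => ?_
    rw [mul_assoc, Finset.mul_prod_erase P h hB]
  rw [euler_apply, setExp_apply, Finset.mul_sum, Finset.sum_congr rfl h1, mul_apply]
  simp only [euler_apply, setExp_apply, Finset.mul_sum]
  rw [Finset.sum_sigma']
  -- The block `∅` has weight zero on the right, while on the left no block is empty.
  have h2 : ∀ B ∈ A.powerset, B ∉ A.powerset.erase ∅ →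
      (∑ Q ∈ blockSets (A \ B), (B.card : ℚ) * h B * ∏ C ∈ Q, h C) = 0 := by
    intro B hB hB'
    have : B = ∅ := by simpa [Finset.mem_powerset.1 hB] using hB'
    simp [this]
  rw [← Finset.sum_subset (Finset.erase_subset _ _) h2, Finset.sum_sigma']
  refine Finset.sum_bij' (fun x _ => ⟨x.2, x.1.erase x.2⟩) (fun x _ => ⟨insert x.1 x.2, x.1⟩)
    ?_ ?_ ?_ ?_ ?_
  · rintro ⟨P, B⟩ hx
    simp only [Finset.mem_sigma, mem_blockSets, Finset.mem_erase, Finset.mem_powerset] at hx ⊢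
    obtain ⟨⟨h0, hd, rfl⟩, hB⟩ := hx
    refine ⟨⟨fun h => h0 (h ▸ hB), Finset.le_sup (f := id) hB⟩, fun h => h0 h.2,
      hd.subset (by simp), ?_⟩
    conv_rhs => rw [← Finset.insert_erase hB, Finset.sup_insert]
    have : Disjoint B ((P.erase B).sup id) := by
      rw [Finset.disjoint_sup_right]
      intro C hC
      exact hd hB (Finset.mem_of_mem_erase hC) (Finset.ne_of_mem_erase hC).symm
    exact (Finset.union_sdiff_cancel_left this).symm
  · rintro ⟨B, Q⟩ hx
    simp only [Finset.mem_sigma, mem_blockSets, Finset.mem_erase, Finset.mem_powerset] at hx ⊢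
    obtain ⟨⟨hB, hBA⟩, h0, hd, hQ⟩ := hx
    refine ⟨⟨?_, ?_, ?_⟩, Finset.mem_insert_self _ _⟩
    · simp [h0, Ne.symm hB]
    · rw [Finset.coe_insert]
      refine hd.insert fun C hC _ => ?_
      have : C ≤ A \ B := hQ ▸ Finset.le_sup (f := id) hC
      exact Finset.disjoint_of_subset_right this Finset.disjoint_sdiff
    · rw [Finset.sup_insert, hQ]
      exact Finset.union_sdiff_of_subset hBA
  · rintro ⟨P, B⟩ hx
    simp only [Finset.mem_sigma] at hx
    simp [Finset.insert_erase hx.2]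
  · rintro ⟨B, Q⟩ hx
    simp only [Finset.mem_sigma, mem_blockSets, Finset.mem_erase, Finset.mem_powerset] at hx
    obtain ⟨⟨hB, hBA⟩, h0, hd, hQ⟩ := hx
    have : B ∉ Q := by
      intro h
      have : B ≤ A \ B := hQ ▸ Finset.le_sup (f := id) h
      obtain ⟨x, hx⟩ := Finset.nonempty_iff_ne_empty.2 hB
      exact (Finset.mem_sdiff.1 (this hx)).2 hx
    simp [Finset.erase_insert this]
  · rintro ⟨P, B⟩ _
    rfl

theorem setExp_add (h k : SetSeries S) : setExp (h + k) = setExp h * setExp k := by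
  refine eq_of_euler_eq (k := euler (h + k)) ?_ ?_ (euler_setExp _) ?_
  · simp [mul_apply_empty]
  · simp [euler_apply]
  · rw [euler_mul, euler_setExp, euler_setExp, euler_add]; ring

theorem setExp_zero : setExp (0 : SetSeries S) = 1 := by
  refine eq_of_euler_eq (k := 0) ?_ rfl ?_ ?_
  · simp [one_apply]
  · rw [euler_setExp]; congr 1; ext A; simp [euler_apply]
  · rw [zero_mul]; ext A; by_cases h : A = ∅ <;> simp [euler_apply, one_apply, h]

theorem setExp_mul_setExp_neg (h : SetSeries S) : setExp h * setExp (-h) = 1 := by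
  rw [← setExp_add, add_neg_cancel, setExp_zero]

/-- If `h` lives on sets satisfying `p`, then `setExp h` lives on disjoint unions of such sets. -/
theorem setExp_apply_eq_zero {h : SetSeries S} {A : Finset S}
    (H : ∀ P ∈ blockSets A, ∃ B ∈ P, h B = 0) : setExp h A = 0 :=
  Finset.sum_eq_zero fun P hP => by
    obtain ⟨B, hB, h0⟩ := H P hP
    exact Finset.prod_eq_zero hB h0

end Exp

end SetSeries

/-! ### Powers of exponentials, dressing and Lagrange inversion -/

namespace SetSeries

section Dress

variable {S : Type u} [DecidableEq S]

instance : Algebra ℚ (SetSeries S) :=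
  Algebra.ofModule smul_mul fun z f g => by
    rw [SetSeries.mul_comm, smul_mul, SetSeries.mul_comm]

/-- The indicator of the single set `B`. -/
def delta (B : Finset S) : SetSeries S := fun A => if A = B then 1 else 0

theorem delta_mul_apply (B : Finset S) (f : SetSeries S) (A : Finset S) :
    (delta B * f) A = if B ⊆ A then f (A \ B) else 0 := by
  simp [mul_apply, delta]

theorem delta_mul_delta {B C : Finset S} (h : Disjoint B C) :
    delta B * delta C = delta (B ∪ C) := by
  ext A
  rw [delta_mul_apply]
  simp only [delta]
  by_cases hA : A = B ∪ C
  · subst hA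
    simp [Finset.union_sdiff_cancel_left h]
  · rw [if_neg hA]
    split_ifs with h1 h2
    · exact absurd (by rw [← h2, Finset.union_sdiff_of_subset h1]) hA
    · rfl
    · rfl

theorem delta_mul_delta_of_not_disjoint {B C : Finset S} (h : ¬ Disjoint B C) :
    delta B * delta C = 0 := by
  ext A
  rw [delta_mul_apply]
  simp only [delta, zero_apply]
  split_ifs with h1 h2
  · exact absurd (h2 ▸ Finset.disjoint_sdiff) h
  · rfl
  · rfl

variable [Fintype S]

/-- The powers of `setExp h`, with arbitrary rational exponents. -/
noncomputable def expPow (h : SetSeries S) (z : ℚ) : SetSeries S := setExp (z • h)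

theorem expPow_add (h : SetSeries S) (z w : ℚ) :
    expPow h (z + w) = expPow h z * expPow h w := by
  rw [expPow, add_smul, setExp_add]; rfl

theorem expPow_zero (h : SetSeries S) : expPow h 0 = 1 := by
  rw [expPow, zero_smul, setExp_zero]

theorem expPow_one (h : SetSeries S) : expPow h 1 = setExp h := by
  rw [expPow, one_smul]

/-- Dressing: replace every element `s` of a set by `s` times `setExp h`. -/
noncomputable def dress (h f : SetSeries S) : SetSeries S :=
  ∑ B, f B • (delta B * expPow h B.card)

theorem dress_apply (h f : SetSeries S) (A : Finset S) :
    dress h f A = ∑ B ∈ A.powerset, f B * expPow h B.card (A \ B) := by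
  simp only [dress, sum_apply, smul_apply, delta_mul_apply, mul_ite, mul_zero]
  rw [← Finset.sum_filter]
  refine Finset.sum_congr ?_ fun _ _ => rfl
  ext B; simp

theorem dress_add (h f g : SetSeries S) : dress h (f + g) = dress h f + dress h g := by
  simp [dress, add_smul, Finset.sum_add_distrib]

theorem dress_mul (h f g : SetSeries S) : dress h (f * g) = dress h f * dress h g := by
  have h1 : ∀ B C : Finset S, f B • (delta B * expPow h B.card) *
      g C • (delta C * expPow h C.card) =
      if Disjoint B C then (f B * g C) • (delta (B ∪ C) * expPow h (B ∪ C).card) else 0 := by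
    intro B C
    have : f B • (delta B * expPow h B.card) * g C • (delta C * expPow h C.card) =
        (f B * g C) • (delta B * delta C * (expPow h B.card * expPow h C.card)) := by
      rw [smul_mul_smul_comm]; congr 1; ring
    rw [this]
    split_ifs with hd
    · rw [delta_mul_delta hd, ← expPow_add, Finset.card_union_of_disjoint hd, Nat.cast_add]
    · rw [delta_mul_delta_of_not_disjoint hd, zero_mul, smul_zero]
  rw [dress, dress, dress, Finset.sum_mul_sum]
  simp only [h1, mul_apply, Finset.sum_smul]
  rw [← Finset.sum_product', ← Finset.sum_filter, Finset.sum_sigma']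
  refine Finset.sum_bij' (fun x _ => (x.2, x.1 \ x.2)) (fun x _ => ⟨x.1 ∪ x.2, x.1⟩) ?_ ?_ ?_ ?_ ?_
  · rintro ⟨A, B⟩ _
    simp [Finset.disjoint_sdiff]
  · rintro ⟨B, C⟩ _
    simp only [Finset.mem_sigma, Finset.mem_univ, true_and, Finset.mem_powerset]
    exact Finset.subset_union_left
  · rintro ⟨A, B⟩ hx
    simp only [Finset.mem_sigma, Finset.mem_univ, true_and, Finset.mem_powerset] at hx
    simp [Finset.union_eq_right.2 hx]
  · rintro ⟨B, C⟩ hx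
    simp only [Finset.mem_filter, Finset.mem_product, Finset.mem_univ, true_and] at hx
    simp [Finset.union_sdiff_cancel_left hx]
  · rintro ⟨A, B⟩ hx
    simp only [Finset.mem_sigma, Finset.mem_univ, true_and, Finset.mem_powerset] at hx
    simp [Finset.union_sdiff_of_subset hx]

/-- Multiplication by `1 + euler h` multiplies the coefficients of `expPow h z` on `k`-element sets by
`(z + k) / z`; they vanish for `z = -k`, which is what makes Lagrange inversion work. -/
theorem mul_expPow_mul_one_add_euler (h : SetSeries S) (z : ℚ) (A : Finset S) :
    z * (expPow h z * (1 + euler h)) A = (z + A.card) * expPow h z A := by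
  have h1 : z • (expPow h z * (1 + euler h)) = z • expPow h z + euler (expPow h z) := by
    rw [expPow, euler_setExp, euler_smul, smul_mul_assoc, mul_add, mul_one, smul_add, mul_comm]
  have h2 := congrFun h1 A
  simp only [smul_apply, add_apply, euler_apply] at h2
  rw [h2]; ring

/-- Lagrange inversion: if substituting `s * setExp h` for every `s` turns `f` into `setExp h - 1`, then
the top coefficient of `f` is read off from a negative power of `setExp h`. -/
theorem lagrange_inversion {h f : SetSeries S} (hS : 2 ≤ Fintype.card S)
    (hf : dress h f = setExp h - 1) :
    (1 - (Fintype.card S : ℚ)) * f Finset.univ = expPow h (1 - Fintype.card S) Finset.univ := by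
  set n : ℚ := (Fintype.card S : ℚ) with hn
  have hn2 : (2 : ℚ) ≤ n := by rw [hn]; exact_mod_cast hS
  -- Multiply by `expPow h (-n) * (1 + euler h)`. On a set of `k` elements, the coefficient of
  -- `expPow h (-k) * (1 + euler h)` vanishes for `k ≠ 0`, so only the full set contributes.
  have hL : (dress h f * (expPow h (-n) * (1 + euler h))) Finset.univ = f Finset.univ := by
    have h1 : dress h f * (expPow h (-n) * (1 + euler h)) =
        ∑ B, f B • (delta B * (expPow h (B.card - n) * (1 + euler h))) := by
      rw [dress, Finset.sum_mul]
      refine Finset.sum_congr rfl fun B _ => ?_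
      rw [smul_mul_assoc, sub_eq_add_neg, expPow_add]
      congr 1; ring
    rw [h1, sum_apply, Finset.sum_eq_single Finset.univ]
    · rw [smul_apply, delta_mul_apply, if_pos subset_rfl, Finset.sdiff_self, Finset.card_univ,
        ← hn, sub_self, expPow_zero, one_mul, add_apply, euler_apply, one_apply]
      simp
    · intro B _ hB
      rw [smul_apply, delta_mul_apply, if_pos (Finset.subset_univ B)]
      have h2 := mul_expPow_mul_one_add_euler h (B.card - n) (Finset.univ \ B)
      have h3 : ((Finset.univ \ B).card : ℚ) = n - B.card := by
        rw [Finset.card_sdiff_of_subset (Finset.subset_univ B), Finset.card_univ,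
          Nat.cast_sub (Finset.card_le_univ B)]
      have h4 : (B.card : ℚ) - n ≠ 0 := by
        have := Finset.card_lt_univ_of_notMem (s := B) (x := _)
          (Classical.choose_spec (by
            by_contra hc; push Not at hc
            exact hB (Finset.eq_univ_of_forall hc) : ∃ x, x ∉ B))
        have : (B.card : ℚ) < n := by rw [hn]; exact_mod_cast this
        linarith
      rw [h3, sub_add_sub_cancel, sub_self, zero_mul] at h2
      rw [(mul_eq_zero.1 h2).resolve_left h4, mul_zero]
    · simp
  have hR : dress h f * (expPow h (-n) * (1 + euler h)) =
      expPow h (1 - n) * (1 + euler h) - expPow h (-n) * (1 + euler h) := by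
    rw [hf, sub_eq_add_neg (1 : ℚ), expPow_add, expPow_one]; ring
  have h5 := mul_expPow_mul_one_add_euler h (-n) Finset.univ
  have h6 := mul_expPow_mul_one_add_euler h (1 - n) Finset.univ
  rw [Finset.card_univ, ← hn, neg_add_cancel, zero_mul] at h5
  rw [Finset.card_univ, ← hn, sub_add_cancel, one_mul] at h6
  rw [← hL, hR, sub_apply, (mul_eq_zero.1 h5).resolve_left (by linarith), sub_zero, h6]

end Dress

section Orders

variable {S : Type u}

/-- The series counting cyclic orders. -/
def cyc : SetSeries S := fun A => if A.card = 0 then 0 else ((A.card - 1)! : ℚ)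

/-- The series counting linear orders. -/
def lin : SetSeries S := fun A => (A.card ! : ℚ)

/-- The indicator of the one-element sets. -/
def singles : SetSeries S := fun A => if A.card = 1 then 1 else 0

theorem euler_singles : euler (singles : SetSeries S) = singles := by
  ext A
  by_cases h : A.card = 1 <;> simp [euler_apply, singles, h]

variable [DecidableEq S]

theorem euler_cyc : euler (cyc : SetSeries S) = lin - 1 := by
  ext A
  rcases A.eq_empty_or_nonempty with rfl | hA
  · simp [euler_apply, cyc, lin, one_apply]
  · simp only [euler_apply, cyc, lin, one_apply, sub_apply, hA.ne_empty, hA.card_pos.ne', if_false,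
      sub_zero]
    exact_mod_cast Nat.mul_factorial_pred hA.card_pos.ne'

theorem singles_mul_apply (f : SetSeries S) (A : Finset S) :
    ((singles : SetSeries S) * f) A = ∑ s ∈ A, f (A.erase s) := by
  rw [mul_apply]
  simp only [singles, ite_mul, one_mul, zero_mul]
  rw [← Finset.sum_filter]
  symm
  refine Finset.sum_bij (fun s _ => {s}) ?_ ?_ ?_ ?_
  · intro s hs; simp [hs]
  · intro s _ t _ h; simpa using h
  · intro B hB
    simp only [Finset.mem_filter, Finset.mem_powerset] at hB
    obtain ⟨s, rfl⟩ := Finset.card_eq_one.1 hB.2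
    exact ⟨s, by simpa using hB.1, rfl⟩
  · intro s _; rw [Finset.sdiff_singleton_eq_erase]

theorem singles_mul_lin : singles * lin = (lin - 1 : SetSeries S) := by
  ext A
  rw [singles_mul_apply]
  rcases A.eq_empty_or_nonempty with rfl | hA
  · simp [lin, one_apply]
  · have : ∀ s ∈ A, lin (A.erase s) = ((A.card - 1)! : ℚ) := fun s hs => by
      rw [lin, Finset.card_erase_of_mem hs]
    rw [Finset.sum_congr rfl this, sub_apply, one_apply, if_neg hA.ne_empty, lin]
    simp only [Finset.sum_const, nsmul_eq_mul, sub_zero]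
    exact_mod_cast Nat.mul_factorial_pred hA.card_pos.ne'

variable [Fintype S]

/-- A linear order is a permutation, hence a set of cyclic orders. -/
theorem setExp_cyc : setExp cyc = (lin : SetSeries S) := by
  refine eq_of_euler_eq (k := euler cyc) (by simp [lin]) (by simp [euler_apply])
    (euler_setExp _) ?_
  have h1 : (1 - singles) * lin = (1 : SetSeries S) := by
    rw [sub_mul, one_mul, singles_mul_lin]; ring
  have h2 := congrArg euler h1
  have h4 : euler (1 : SetSeries S) = 0 := by
    ext A; by_cases h : A = ∅ <;> simp [euler_apply, one_apply, h]
  have h3 : euler (1 - singles : SetSeries S) = -singles := by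
    have h : euler (singles + (1 - singles) : SetSeries S) = euler 1 := by rw [add_sub_cancel]
    rw [euler_add, h4, euler_singles] at h
    linear_combination h
  rw [euler_mul, h3, h4] at h2
  have h5 : (1 - singles) * euler lin = (singles * lin : SetSeries S) := by linear_combination h2
  rw [euler_cyc, ← singles_mul_lin]
  linear_combination (lin : SetSeries S) * h5 - euler (lin : SetSeries S) * h1

end Orders

end SetSeries

/-! ### Wiener-Hopf factorization by the sign of the weight -/

namespace SetSeries

section WienerHopf

theorem neg_ne_zero {σ : SignType} (hσ : σ ≠ 0) : -σ ≠ 0 := by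
  revert σ; decide

theorem ne_neg_self {σ : SignType} (hσ : σ ≠ 0) : σ ≠ -σ := by
  revert σ; decide

variable {S : Type u} (wt : S → ℝ)

/-- The sign of the total weight of `A`. -/
noncomputable def wsign (A : Finset S) : SignType := SignType.sign (∑ s ∈ A, wt s)

/-- The part of `f` on the sets whose total weight has sign `σ`. -/
noncomputable def cut (σ : SignType) (f : SetSeries S) : SetSeries S :=
  fun A => if wsign wt A = σ then f A else 0

/-- The series `f` vanishes on the sets whose total weight has sign `σ`. -/
def Avoids (σ : SignType) (f : SetSeries S) : Prop := ∀ A, wsign wt A = σ → f A = 0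

theorem cut_apply (σ : SignType) (f : SetSeries S) (A : Finset S) :
    cut wt σ f A = if wsign wt A = σ then f A else 0 := rfl

theorem cut_add (σ : SignType) (f g : SetSeries S) :
    cut wt σ (f + g) = cut wt σ f + cut wt σ g := by
  ext A; simp only [cut_apply, add_apply]; split_ifs <;> simp

theorem cut_sub (σ : SignType) (f g : SetSeries S) :
    cut wt σ (f - g) = cut wt σ f - cut wt σ g := by
  ext A; simp only [cut_apply, sub_apply]; split_ifs <;> simp

theorem cut_add_cut_add_cut {σ : SignType} (hσ : σ ≠ 0) (f : SetSeries S) :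
    cut wt σ f + cut wt 0 f + cut wt (-σ) f = f := by
  ext A
  simp only [cut_apply, add_apply]
  generalize wsign wt A = τ
  cases σ <;> cases τ <;> simp at hσ ⊢

theorem cut_cut {σ τ : SignType} (h : σ ≠ τ) (f : SetSeries S) :
    cut wt σ (cut wt τ f) = 0 := by
  ext A
  simp only [cut_apply, zero_apply]
  split_ifs with h1 h2
  · exact absurd (h1.symm.trans h2) h
  all_goals rfl

theorem wsign_empty : wsign wt ∅ = 0 := by simp [wsign]

variable {wt}

theorem avoids_cut {σ τ : SignType} (h : σ ≠ τ) (f : SetSeries S) :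
    Avoids wt σ (cut wt τ f) := fun A hA => by rw [cut_apply, if_neg (hA ▸ h)]

theorem Avoids.cut_eq_zero {σ : SignType} {f : SetSeries S} (h : Avoids wt σ f) :
    cut wt σ f = 0 := by
  ext A
  rw [cut_apply]
  split_ifs with hA
  · exact h A hA
  · rfl

theorem Avoids.sub {σ : SignType} {f g : SetSeries S} (hf : Avoids wt σ f)
    (hg : Avoids wt σ g) : Avoids wt σ (f - g) := fun A hA => by
  rw [sub_apply, hf A hA, hg A hA, sub_zero]

/-- The reals of sign other than `σ ≠ 0` form a closed half-line, so a sum of two of them does not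
have sign `σ`, and it is zero only if both are. -/
theorem sign_add_eq {x y : ℝ} {σ : SignType} (hσ : σ ≠ 0) (hx : SignType.sign x ≠ σ)
    (hy : SignType.sign y ≠ σ) : SignType.sign (x + y) ≠ σ ∧
      (SignType.sign (x + y) = 0 → SignType.sign x = 0 ∧ SignType.sign y = 0) := by
  rcases lt_trichotomy x 0 with h1 | h1 | h1 <;> rcases lt_trichotomy y 0 with h2 | h2 | h2 <;>
  cases σ <;> simp_all [sign_pos, sign_neg, add_pos, add_neg]

theorem cut_zero_singles (h0 : ∀ s, wt s ≠ 0) : cut wt 0 (singles : SetSeries S) = 0 := by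
  ext A
  rw [cut_apply]
  split_ifs with h
  · rw [singles, if_neg]
    · rfl
    intro hA
    obtain ⟨s, rfl⟩ := Finset.card_eq_one.1 hA
    simp [wsign, h0 s] at h
  · rfl

theorem neg_cut_apply (σ : SignType) (B : Finset S) (h : wsign wt B ≠ σ) :
    (-cut wt σ cyc) B = 0 := by rw [neg_apply, cut_apply, if_neg h, neg_zero]

variable [DecidableEq S]

theorem wsign_eq_sign_add {A B : Finset S} (h : B ⊆ A) :
    wsign wt A = SignType.sign (∑ s ∈ B, wt s + ∑ s ∈ A \ B, wt s) := by
  rw [wsign, add_comm, Finset.sum_sdiff h]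

theorem Avoids.mul {σ : SignType} (hσ : σ ≠ 0) {f g : SetSeries S} (hf : Avoids wt σ f)
    (hg : Avoids wt σ g) : Avoids wt σ (f * g) := fun A hA => by
  rw [mul_apply]
  refine Finset.sum_eq_zero fun B hB => ?_
  by_contra h
  obtain ⟨h1, h2⟩ := ne_zero_and_ne_zero_of_mul h
  rw [wsign_eq_sign_add (Finset.mem_powerset.1 hB)] at hA
  exact (sign_add_eq hσ (fun h => h1 (hf B h)) (fun h => h2 (hg _ h))).1 hA

theorem avoids_one {σ : SignType} (hσ : σ ≠ 0) : Avoids wt σ 1 := fun A hA => by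
  rw [one_apply, if_neg]
  rintro rfl
  exact hσ (hA ▸ wsign_empty wt)

theorem cut_zero_one : cut wt 0 (1 : SetSeries S) = 1 := by
  ext A
  rw [cut_apply, one_apply]
  by_cases h : A = ∅
  · simp [h, wsign_empty]
  · simp [h]

/-- On series supported on one closed half-line, taking the weight zero part is multiplicative. -/
theorem cut_zero_mul {σ : SignType} (hσ : σ ≠ 0) {f g : SetSeries S} (hf : Avoids wt σ f)
    (hg : Avoids wt σ g) : cut wt 0 (f * g) = cut wt 0 f * cut wt 0 g := by
  ext A
  rw [cut_apply, mul_apply, mul_apply]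
  split_ifs with hA
  · refine Finset.sum_congr rfl fun B hB => ?_
    rw [wsign_eq_sign_add (Finset.mem_powerset.1 hB)] at hA
    by_cases h1 : wsign wt B = σ
    · rw [cut_apply, hf B h1]; simp
    by_cases h2 : wsign wt (A \ B) = σ
    · rw [cut_apply wt 0 g, hg _ h2]; simp
    obtain ⟨h3, h4⟩ := (sign_add_eq hσ h1 h2).2 hA
    rw [cut_apply, cut_apply, wsign, wsign, if_pos h3, if_pos h4]
  · symm
    refine Finset.sum_eq_zero fun B hB => ?_
    rw [wsign_eq_sign_add (Finset.mem_powerset.1 hB)] at hA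
    rw [cut_apply, cut_apply]
    split_ifs with h1 h2
    · exfalso
      rw [wsign, sign_eq_zero_iff] at h1 h2
      simp [h1, h2] at hA
    all_goals simp

variable [Fintype S]

/-- The exponential of a series living on sets of sign `σ` again lives on such sets, apart from its
constant term: the union of a nonempty family of disjoint sets of sign `σ` has sign `σ`. -/
theorem setExp_cut_apply {σ : SignType} {h : SetSeries S} (hh : ∀ B, wsign wt B ≠ σ → h B = 0)
    {A : Finset S} (hA : A ≠ ∅) (hσ : wsign wt A ≠ σ) : setExp h A = 0 := by
  refine setExp_apply_eq_zero fun P hP => ?_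
  by_contra! hc
  obtain ⟨-, hd, rfl⟩ := mem_blockSets.1 hP
  refine hσ ?_
  rw [wsign, Finset.sup_eq_biUnion, Finset.sum_biUnion fun x hx y hy hxy => hd hx hy hxy]
  have hne : P.Nonempty := by
    rw [Finset.nonempty_iff_ne_empty]; rintro rfl; simp at hA
  have h1 : ∀ B ∈ P, SignType.sign (∑ s ∈ B, wt s) = σ := fun B hB => by
    by_contra h; exact hc B hB (hh B h)
  clear hP hd hc hσ hA
  induction hne using Finset.Nonempty.cons_induction with
  | singleton B => simpa using h1
  | cons B P hB hP ih =>
    rw [Finset.sum_cons]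
    have h2 := h1 B (Finset.mem_cons_self _ _)
    have h3 := ih fun C hC => h1 C (Finset.mem_cons_of_mem hC)
    cases σ
    · simp only [SignType.zero_eq_zero, sign_eq_zero_iff] at *
      simp only [id] at *
      rw [h2, h3, add_zero]
    · simp only [SignType.neg_eq_neg_one, sign_eq_neg_one_iff] at *
      exact add_neg h2 h3
    · simp only [SignType.pos_eq_one, sign_eq_one_iff] at *
      exact add_pos h2 h3

theorem avoids_setExp {σ τ : SignType} (hτ : τ ≠ 0) (hστ : τ ≠ σ) {h : SetSeries S}
    (hh : ∀ B, wsign wt B ≠ σ → h B = 0) : Avoids wt τ (setExp h) := fun A hA => by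
  refine setExp_cut_apply hh ?_ (hA ▸ hστ)
  rintro rfl
  exact hτ (hA ▸ wsign_empty wt)

theorem cut_zero_setExp {σ : SignType} (hσ : σ ≠ 0) {h : SetSeries S}
    (hh : ∀ B, wsign wt B ≠ σ → h B = 0) : cut wt 0 (setExp h) = 1 := by
  ext A
  rw [cut_apply, one_apply]
  by_cases h : A = ∅
  · simp [h, wsign_empty]
  · rw [if_neg h]
    split_ifs with h0
    · exact setExp_cut_apply hh h (h0 ▸ hσ.symm)
    · rfl

theorem cut_zero_setExp_zero {h : SetSeries S}
    (hh : ∀ B, wsign wt B ≠ 0 → h B = 0) : cut wt 0 (setExp h) = setExp h := by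
  ext A
  rw [cut_apply]
  split_ifs with h0
  · rfl
  · refine (setExp_cut_apply hh ?_ h0).symm
    rintro rfl
    exact h0 (wsign_empty wt)

variable (wt)

/-- The zero factor: linear orders all of whose cycles have weight zero. -/
noncomputable def level : SetSeries S := setExp (cut wt 0 cyc)

/-- The ladder series: `1 - ladder σ` is the factor with sign `σ` in the Wiener-Hopf factorization
of `1 - singles`. -/
noncomputable def ladder (σ : SignType) : SetSeries S := 1 - setExp (-cut wt σ cyc)

/-- The series `(σ-part of singles) * level / (1 - ladder (-σ))`. -/
noncomputable def walk (σ : SignType) : SetSeries S :=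
  cut wt σ singles * level wt * setExp (cut wt (-σ) cyc)

theorem wiener_hopf {σ : SignType} (hσ : σ ≠ 0) :
    (1 - singles) * level wt = (1 - ladder wt σ) * (1 - ladder wt (-σ)) := by
  have h1 : (1 - singles) * lin = (1 : SetSeries S) := by
    rw [sub_mul, one_mul, singles_mul_lin]; ring
  have h2 := setExp_cyc (S := S)
  rw [← cut_add_cut_add_cut wt hσ cyc, setExp_add, setExp_add] at h2
  have h3 := setExp_mul_setExp_neg (cut wt σ (cyc : SetSeries S))
  have h4 := setExp_mul_setExp_neg (cut wt (-σ) (cyc : SetSeries S))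
  simp only [ladder, level, sub_sub_cancel]
  rw [← h2] at h1
  calc _ = (1 - singles) * (setExp (cut wt σ cyc) * setExp (-cut wt σ cyc)) * setExp (cut wt 0 cyc)
        * (setExp (cut wt (-σ) cyc) * setExp (-cut wt (-σ) cyc)) := by rw [h3, h4]; ring
    _ = ((1 - singles) * (setExp (cut wt σ cyc) * setExp (cut wt 0 cyc) *
          setExp (cut wt (-σ) cyc))) * (setExp (-cut wt σ cyc) * setExp (-cut wt (-σ) cyc)) := by
        ring
    _ = _ := by rw [h1, one_mul]

theorem walk_eq_add {σ : SignType} :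
    walk wt σ = cut wt σ singles * level wt + walk wt σ * ladder wt (-σ) := by
  have h4 := setExp_mul_setExp_neg (cut wt (-σ) (cyc : SetSeries S))
  rw [walk, ladder]
  linear_combination (cut wt σ singles * level wt) * h4

variable {wt}

/-- The factorization, divided by the factor of sign `-σ`. The last term avoids sign `σ`, so the part of
`walk wt σ` of sign `σ` can be read off. -/
theorem walk_eq {σ : SignType} (hσ : σ ≠ 0) (h0 : ∀ s, wt s ≠ 0) :
    walk wt σ = ladder wt σ - 1 +
      (1 - cut wt (-σ) singles) * level wt * setExp (cut wt (-σ) cyc) := by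
  have h1 := wiener_hopf wt hσ
  have h2 := cut_add_cut_add_cut wt hσ (singles : SetSeries S)
  rw [cut_zero_singles h0, add_zero] at h2
  have h4 := setExp_mul_setExp_neg (cut wt (-σ) (cyc : SetSeries S))
  rw [walk]
  rw [show ladder wt (-σ) = 1 - setExp (-cut wt (-σ) cyc) from rfl] at h1
  linear_combination -setExp (cut wt (-σ) cyc) * h1 + (setExp (cut wt (-σ) cyc) * level wt) * h2
    - (1 - ladder wt σ) * h4

theorem cut_walk_self {σ : SignType} (hσ : σ ≠ 0) (h0 : ∀ s, wt s ≠ 0) :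
    cut wt σ (walk wt σ) = ladder wt σ := by
  have hne := ne_neg_self hσ
  have h1 : Avoids wt σ ((1 - cut wt (-σ) singles) * level wt * setExp (cut wt (-σ) cyc)) :=
    (((avoids_one hσ).sub (avoids_cut hne _)).mul hσ
      (avoids_setExp hσ hσ fun B hB => if_neg hB)).mul hσ
      (avoids_setExp hσ hne fun B hB => if_neg hB)
  have h2 : cut wt σ (ladder wt σ) = ladder wt σ := by
    ext A
    rw [cut_apply]
    split_ifs with h
    · rfl
    · rw [ladder, sub_apply]
      by_cases hA : A = ∅
      · simp [hA, one_apply]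
      · rw [setExp_cut_apply (neg_cut_apply σ) hA h, one_apply, if_neg hA, sub_zero]
  rw [walk_eq hσ h0, cut_add, cut_sub, h1.cut_eq_zero, h2, (avoids_one hσ).cut_eq_zero]
  ring

theorem cut_zero_walk {σ : SignType} (hσ : σ ≠ 0) (h0 : ∀ s, wt s ≠ 0) :
    cut wt 0 (walk wt σ) = level wt - 1 := by
  have hne := ne_neg_self hσ
  have hσ' := neg_ne_zero hσ
  have a1 : Avoids wt σ (1 - cut wt (-σ) singles) :=
    (avoids_one hσ).sub (avoids_cut hne _)
  have a2 : Avoids wt σ (level wt) := avoids_setExp hσ hσ fun B hB => if_neg hB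
  have a3 : Avoids wt σ (setExp (cut wt (-σ) cyc)) :=
    avoids_setExp hσ hne fun B hB => if_neg hB
  have h1 : cut wt 0 (ladder wt σ) = 0 := by
    rw [ladder, cut_sub, cut_zero_one, cut_zero_setExp hσ (neg_cut_apply σ), sub_self]
  rw [walk_eq hσ h0, cut_add, cut_sub, cut_zero_mul hσ (a1.mul hσ a2) a3, cut_zero_mul hσ a1 a2,
    cut_sub, cut_cut wt hσ'.symm, h1, cut_zero_one, cut_zero_setExp hσ' (h := cut wt (-σ) cyc) fun B hB => if_neg hB,
    show cut wt 0 (level wt) = level wt from cut_zero_setExp_zero fun B hB => if_neg hB]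
  ring

/-- Dressing does not change weights, as the exponential of the zero-weight part lives on sets of
weight zero. -/
theorem dress_cut (σ : SignType) (f : SetSeries S) :
    dress (cut wt 0 cyc) (cut wt σ f) = cut wt σ (dress (cut wt 0 cyc) f) := by
  ext A
  have h1 : ∀ B ∈ A.powerset, cut wt σ f B * expPow (cut wt 0 cyc) B.card (A \ B) =
      if wsign wt A = σ then f B * expPow (cut wt 0 cyc) B.card (A \ B) else 0 := by
    intro B hB
    by_cases hz : wsign wt (A \ B) = 0
    · have : wsign wt A = wsign wt B := by
        rw [wsign_eq_sign_add (Finset.mem_powerset.1 hB), sign_eq_zero_iff.1 hz, add_zero, wsign]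
      rw [this, cut_apply, ite_mul, zero_mul]
    · have : expPow (cut wt 0 cyc) B.card (A \ B) = 0 := by
        refine setExp_cut_apply (σ := 0) (fun C hC => ?_) ?_ hz
        · rw [smul_apply, cut_apply, if_neg hC, mul_zero]
        · rintro h; exact hz (h ▸ wsign_empty wt)
      simp [this]
  rw [cut_apply, dress_apply, dress_apply, Finset.sum_congr rfl h1]
  split_ifs <;> simp

theorem dress_singles (σ : SignType) :
    dress (cut wt 0 cyc) (cut wt σ singles) = cut wt σ singles * level wt := by
  ext A
  rw [dress_apply, mul_apply]
  refine Finset.sum_congr rfl fun B _ => ?_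
  by_cases hB : B.card = 1
  · rw [hB, Nat.cast_one, expPow_one]; rfl
  · have : cut wt σ singles B = 0 := by simp [cut_apply, singles, hB]
    rw [this, zero_mul, zero_mul]

/-- Dressing turns the recursion of rooted trees into that of the walk series. -/
theorem dress_eq_walk (h0 : ∀ s, wt s ≠ 0) {t : SignType → SetSeries S}
    (ht : ∀ σ, σ ≠ 0 → t σ = cut wt σ singles + t σ * cut wt (-σ) (t (-σ))) :
    ∀ σ, σ ≠ 0 → dress (cut wt 0 cyc) (t σ) = walk wt σ := by
  have hd : ∀ σ, σ ≠ 0 → dress (cut wt 0 cyc) (t σ) = cut wt σ singles * level wt +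
      dress (cut wt 0 cyc) (t σ) * cut wt (-σ) (dress (cut wt 0 cyc) (t (-σ))) := by
    intro σ hσ
    conv_lhs => rw [ht σ hσ]
    rw [dress_add, dress_mul, dress_singles, dress_cut]
  have hw : ∀ σ, σ ≠ 0 → walk wt σ = cut wt σ singles * level wt +
      walk wt σ * cut wt (-σ) (walk wt (-σ)) := by
    intro σ hσ
    rw [cut_walk_self (neg_ne_zero hσ) h0]
    exact walk_eq_add wt
  have h1 : ∀ σ, σ ≠ 0 → (cut wt σ singles * level wt : SetSeries S) ∅ = 0 := by
    intro σ hσ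
    rw [mul_apply_empty, cut_apply, if_neg (by rw [wsign_empty]; exact hσ.symm), zero_mul]
  have key : ∀ (f : SignType → SetSeries S), (∀ σ, σ ≠ 0 → f σ = cut wt σ singles * level wt +
      f σ * cut wt (-σ) (f (-σ))) → ∀ σ, σ ≠ 0 → f σ ∅ = 0 := by
    intro f hf σ hσ
    rw [hf σ hσ, add_apply, h1 σ hσ, mul_apply_empty, cut_apply, if_neg, mul_zero, zero_add]
    rw [wsign_empty]
    exact (neg_ne_zero hσ).symm
  -- Both families solve the same recursion, which determines them by induction on the set.
  suffices ∀ A σ, σ ≠ 0 → dress (cut wt 0 cyc) (t σ) A = walk wt σ A from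
    fun σ hσ => ext fun A => this A σ hσ
  intro A
  induction A using Finset.strongInduction with
  | H A ih =>
    intro σ hσ
    have hσ' := neg_ne_zero hσ
    rw [hd σ hσ, hw σ hσ, add_apply, add_apply, mul_apply _ _ A, mul_apply _ (cut _ _ _) A]
    congr 1
    refine Finset.sum_congr rfl fun B hB => ?_
    have hBA := Finset.mem_powerset.1 hB
    rcases eq_or_ne B ∅ with rfl | hB0
    · rw [key _ hd σ hσ, key _ hw σ hσ, zero_mul, zero_mul]
    rcases eq_or_ne B A with rfl | hBne
    · rw [Finset.sdiff_self, cut_apply, cut_apply, key _ hd _ hσ', key _ hw _ hσ']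
      simp
    rw [ih B (hBA.ssubset_of_ne hBne) σ hσ, cut_apply, cut_apply,
      ih _ (Finset.sdiff_ssubset hBA (Finset.nonempty_iff_ne_empty.2 hB0)) _ hσ']

/-- The solution of the rooted tree recursion, on the full set when it has weight zero. -/
theorem rooted_tree_series_univ (h0 : ∀ s, wt s ≠ 0) (hsum : ∑ s, wt s = 0)
    (hS : 2 ≤ Fintype.card S) {t : SignType → SetSeries S}
    (ht : ∀ σ, σ ≠ 0 → t σ = cut wt σ singles + t σ * cut wt (-σ) (t (-σ))) :
    (1 - (Fintype.card S : ℚ)) * t 1 Finset.univ =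
      setExp ((1 - (Fintype.card S : ℚ)) • cut wt 0 cyc) Finset.univ := by
  have h1 : dress (cut wt 0 cyc) (cut wt 0 (t 1)) = setExp (cut wt 0 cyc) - 1 := by
    rw [dress_cut, dress_eq_walk h0 ht 1 (by simp), cut_zero_walk (by simp) h0]
    rfl
  have h2 := lagrange_inversion hS h1
  rwa [cut_apply, if_pos (by simp [wsign, hsum])] at h2

end WienerHopf

end SetSeries

/-! ### Deleting and adding an edge of a tree -/

section TreeOn

variable {S : Type u}

/-- `G` is a tree on the vertex set `A`; the vertices outside `A` are isolated. -/
structure SimpleGraph.IsTreeOn (G : SimpleGraph S) (A : Finset S) : Prop where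
  acyclic : G.IsAcyclic
  mem : ∀ x y, G.Adj x y → x ∈ A
  reachable : ∀ x ∈ A, ∀ y ∈ A, G.Reachable x y

/-- The subgraph of the edges with both ends in `A`, as a graph on all of `S`. -/
def SimpleGraph.restrictTo (G : SimpleGraph S) (A : Finset S) : SimpleGraph S where
  Adj x y := G.Adj x y ∧ x ∈ A ∧ y ∈ A
  symm := ⟨fun _ _ h => ⟨h.1.symm, h.2.2, h.2.1⟩⟩
  loopless := ⟨fun _ h => h.1.ne rfl⟩

/-- The union of two graphs and an edge `r c` joining them. -/
def SimpleGraph.join (G₁ G₂ : SimpleGraph S) (r c : S) : SimpleGraph S :=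
  G₁ ⊔ G₂ ⊔ SimpleGraph.edge r c

namespace SimpleGraph

theorem restrictTo_adj {G : SimpleGraph S} {A : Finset S} {x y : S} :
    (G.restrictTo A).Adj x y ↔ G.Adj x y ∧ x ∈ A ∧ y ∈ A := Iff.rfl

theorem join_adj {G₁ G₂ : SimpleGraph S} {r c x y : S} (h : r ≠ c) :
    (G₁.join G₂ r c).Adj x y ↔
      G₁.Adj x y ∨ G₂.Adj x y ∨ (x = r ∧ y = c) ∨ (x = c ∧ y = r) := by
  simp only [join, sup_adj, edge_adj]
  constructor
  · rintro ((h | h) | ⟨h, -⟩) <;> tauto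
  · rintro (h | h | ⟨rfl, rfl⟩ | ⟨rfl, rfl⟩) <;> simp_all [Ne.symm]

theorem Reachable.of_closed {H H' : SimpleGraph S} (P : S → Prop)
    (h : ∀ a b, P a → H.Adj a b → P b ∧ H'.Adj a b) {x y : S} (hx : P x)
    (hr : H.Reachable x y) : P y ∧ H'.Reachable x y := by
  obtain ⟨p⟩ := hr
  induction p with
  | nil => exact ⟨hx, .rfl⟩
  | cons ha _ ih =>
    obtain ⟨h1, h2⟩ := h _ _ hx ha
    obtain ⟨h3, h4⟩ := ih h1
    exact ⟨h3, h2.reachable.trans h4⟩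

theorem IsTreeOn.mem_right {G : SimpleGraph S} {A : Finset S} (h : G.IsTreeOn A) {x y : S}
    (hxy : G.Adj x y) : y ∈ A := h.mem y x hxy.symm

open Classical in
/-- The component of `c` after deletion of the edge `r c`. -/
noncomputable def side [Fintype S] (G : SimpleGraph S) (r c : S) : Finset S :=
  Finset.univ.filter fun x => (G.deleteEdges {s(r, c)}).Reachable c x

theorem mem_side [Fintype S] {G : SimpleGraph S} {r c x : S} :
    x ∈ G.side r c ↔ (G.deleteEdges {s(r, c)}).Reachable c x := by
  simp [side]

section Delete

variable [Fintype S] {G : SimpleGraph S} {A : Finset S} {r c : S}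

theorem self_mem_side : c ∈ G.side r c := mem_side.2 .rfl

theorem IsTreeOn.notMem_side (h : G.IsTreeOn A) (hrc : G.Adj r c) : r ∉ G.side r c := by
  rw [mem_side]
  have := isAcyclic_iff_forall_adj_isBridge.1 h.acyclic hrc
  rw [isBridge_iff] at this
  exact fun hr => this hr.symm

theorem IsTreeOn.side_subset (h : G.IsTreeOn A) (hrc : G.Adj r c) : G.side r c ⊆ A := by
  intro x hx
  exact ((mem_side.1 hx).of_closed (H' := G) (· ∈ A)
    (fun a b _ hab => ⟨h.mem_right (deleteEdges_adj.1 hab).1, (deleteEdges_adj.1 hab).1⟩)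
    (h.mem_right hrc)).1

/-- The edge `r c` is the only one that leaves the component of `c`. -/
theorem IsTreeOn.eq_of_adj_side (h : G.IsTreeOn A) (hrc : G.Adj r c) {x y : S} (hxy : G.Adj x y)
    (hx : x ∈ G.side r c) (hy : y ∉ G.side r c) : x = c ∧ y = r := by
  by_cases he : s(x, y) = s(r, c)
  · rcases Sym2.eq_iff.1 he with ⟨rfl, rfl⟩ | h
    · exact absurd hx (h.notMem_side hrc)
    · exact h
  · exact absurd (mem_side.2 ((mem_side.1 hx).trans
      (Adj.reachable (deleteEdges_adj.2 ⟨hxy, by simpa using he⟩)))) hy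

theorem IsTreeOn.restrictTo_side (h : G.IsTreeOn A) :
    (G.restrictTo (G.side r c)).IsTreeOn (G.side r c) where
  acyclic := h.acyclic.anti fun _ _ h => h.1
  mem _ _ h := h.2.1
  reachable := by
    have : ∀ x ∈ G.side r c, (G.restrictTo (G.side r c)).Reachable c x := fun x hx =>
      ((mem_side.1 hx).of_closed (H' := G.restrictTo (G.side r c)) (· ∈ G.side r c)
        (fun a b ha hab => by
          have hb : b ∈ G.side r c := mem_side.2 ((mem_side.1 ha).trans hab.reachable)
          exact ⟨hb, (deleteEdges_adj.1 hab).1, ha, hb⟩) self_mem_side).2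
    exact fun x hx y hy => (this x hx).symm.trans (this y hy)

theorem IsTreeOn.restrictTo_sdiff_side [DecidableEq S] (h : G.IsTreeOn A) (hrc : G.Adj r c) :
    (G.restrictTo (A \ G.side r c)).IsTreeOn (A \ G.side r c) where
  acyclic := h.acyclic.anti fun _ _ h => h.1
  mem _ _ h := h.2.1
  reachable := by
    have h1 : ∀ x, G.Reachable r x →
        (G.deleteEdges {s(r, c)}).Reachable r x ∨ x ∈ G.side r c := by
      intro x hx
      refine (hx.of_closed (H' := G) (fun x => (G.deleteEdges {s(r, c)}).Reachable r x ∨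
        x ∈ G.side r c) (fun a b ha hab => ⟨?_, hab⟩) (Or.inl .rfl)).1
      by_cases hb : b ∈ G.side r c
      · exact Or.inr hb
      rcases ha with ha | ha
      · by_cases he : s(a, b) = s(r, c)
        · rcases Sym2.eq_iff.1 he with ⟨rfl, rfl⟩ | ⟨rfl, rfl⟩
          · exact Or.inr self_mem_side
          · exact Or.inl .rfl
        · exact Or.inl (ha.trans (Adj.reachable (deleteEdges_adj.2 ⟨hab, by simpa using he⟩)))
      · obtain ⟨rfl, rfl⟩ := h.eq_of_adj_side hrc hab ha hb
        exact Or.inl .rfl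
    have hr := h.notMem_side hrc
    have h2 : ∀ x ∈ A \ G.side r c, (G.restrictTo (A \ G.side r c)).Reachable r x := by
      intro x hx
      rw [Finset.mem_sdiff] at hx
      have h3 := (h1 x (h.reachable r (h.mem r c hrc) x hx.1)).resolve_right hx.2
      refine (h3.of_closed (· ∈ A \ G.side r c) (fun a b ha hab => ?_)
        (Finset.mem_sdiff.2 ⟨h.mem r c hrc, hr⟩)).2
      rw [Finset.mem_sdiff] at ha
      have hb : b ∈ A \ G.side r c := Finset.mem_sdiff.2
        ⟨h.mem_right (deleteEdges_adj.1 hab).1,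
          fun hb => ha.2 (mem_side.2 ((mem_side.1 hb).trans hab.symm.reachable))⟩
      exact ⟨hb, (deleteEdges_adj.1 hab).1, Finset.mem_sdiff.2 ha, hb⟩
    exact fun x hx y hy => (h2 x hx).symm.trans (h2 y hy)

theorem IsTreeOn.join_restrictTo [DecidableEq S] (h : G.IsTreeOn A) (hrc : G.Adj r c) :
    (G.restrictTo (A \ G.side r c)).join (G.restrictTo (G.side r c)) r c = G := by
  ext x y
  rw [join_adj hrc.ne, restrictTo_adj, restrictTo_adj]
  constructor
  · rintro (h | h | ⟨rfl, rfl⟩ | ⟨rfl, rfl⟩)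
    exacts [h.1, h.1, hrc, hrc.symm]
  · intro hxy
    by_cases hx : x ∈ G.side r c <;> by_cases hy : y ∈ G.side r c
    · exact Or.inr (Or.inl ⟨hxy, hx, hy⟩)
    · exact Or.inr (Or.inr (Or.inr (h.eq_of_adj_side hrc hxy hx hy)))
    · exact Or.inr (Or.inr (Or.inl (h.eq_of_adj_side hrc hxy.symm hy hx).symm))
    · exact Or.inl ⟨hxy, Finset.mem_sdiff.2 ⟨h.mem x y hxy, hx⟩,
        Finset.mem_sdiff.2 ⟨h.mem_right hxy, hy⟩⟩

end Delete

section Join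

variable {G₁ G₂ : SimpleGraph S} {A₁ A₂ : Finset S} {r c : S}

theorem IsTreeOn.restrictTo_join_left (h₁ : G₁.IsTreeOn A₁) (h₂ : G₂.IsTreeOn A₂)
    (hd : Disjoint A₁ A₂) (hr : r ∈ A₁) (hc : c ∈ A₂) :
    (G₁.join G₂ r c).restrictTo A₁ = G₁ := by
  have hne : r ≠ c := fun h => Finset.disjoint_left.1 hd hr (h ▸ hc)
  ext x y
  rw [restrictTo_adj, join_adj hne]
  constructor
  · rintro ⟨h | h | ⟨rfl, rfl⟩ | ⟨rfl, rfl⟩, hx, hy⟩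
    · exact h
    · exact absurd (h₂.mem x y h) (Finset.disjoint_left.1 hd hx)
    · exact absurd hc (Finset.disjoint_left.1 hd hy)
    · exact absurd hc (Finset.disjoint_left.1 hd hx)
  · exact fun h => ⟨Or.inl h, h₁.mem x y h, h₁.mem_right h⟩

theorem join_comm : G₁.join G₂ r c = G₂.join G₁ c r := by
  rw [join, join, sup_comm G₁, edge_comm]

theorem IsTreeOn.restrictTo_join_right (h₁ : G₁.IsTreeOn A₁) (h₂ : G₂.IsTreeOn A₂)
    (hd : Disjoint A₁ A₂) (hr : r ∈ A₁) (hc : c ∈ A₂) :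
    (G₁.join G₂ r c).restrictTo A₂ = G₂ := by
  rw [join_comm]; exact h₂.restrictTo_join_left h₁ hd.symm hc hr

theorem IsTreeOn.join [DecidableEq S] (h₁ : G₁.IsTreeOn A₁) (h₂ : G₂.IsTreeOn A₂)
    (hd : Disjoint A₁ A₂) (hr : r ∈ A₁) (hc : c ∈ A₂) :
    (G₁.join G₂ r c).IsTreeOn (A₁ ∪ A₂) := by
  have hne : r ≠ c := fun h => Finset.disjoint_left.1 hd hr (h ▸ hc)
  have cl₁ : ∀ a b, a ∈ A₁ → (G₁ ⊔ G₂).Adj a b → b ∈ A₁ ∧ G₁.Adj a b := by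
    rintro a b ha (hab | hab)
    · exact ⟨h₁.mem_right hab, hab⟩
    · exact absurd (h₂.mem a b hab) (Finset.disjoint_left.1 hd ha)
  have cl₂ : ∀ a b, a ∈ A₂ → (G₁ ⊔ G₂).Adj a b → b ∈ A₂ ∧ G₂.Adj a b := by
    rintro a b ha (hab | hab)
    · exact absurd ha (Finset.disjoint_left.1 hd (h₁.mem a b hab))
    · exact ⟨h₂.mem_right hab, hab⟩
  refine ⟨?_, ?_, ?_⟩
  · refine IsAcyclic.sup_edge_of_not_reachable (fun h => ?_) ?_
    · exact Finset.disjoint_left.1 hd (h.of_closed (H' := G₁) (· ∈ A₁) cl₁ hr).1 hc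
    · rw [isAcyclic_iff_forall_adj_isBridge]
      intro x y hxy
      rw [isBridge_iff]
      intro hre
      rcases hxy with hxy | hxy
      · have h3 := isBridge_iff.1 (isAcyclic_iff_forall_adj_isBridge.1 h₁.acyclic hxy)
        refine h3 (hre.of_closed (· ∈ A₁) (fun a b ha hab => ?_) (h₁.mem x y hxy)).2
        rw [deleteEdges_adj] at hab
        have := cl₁ a b ha hab.1
        exact ⟨this.1, deleteEdges_adj.2 ⟨this.2, hab.2⟩⟩
      · have h3 := isBridge_iff.1 (isAcyclic_iff_forall_adj_isBridge.1 h₂.acyclic hxy)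
        refine h3 (hre.of_closed (· ∈ A₂) (fun a b ha hab => ?_) (h₂.mem x y hxy)).2
        rw [deleteEdges_adj] at hab
        have := cl₂ a b ha hab.1
        exact ⟨this.1, deleteEdges_adj.2 ⟨this.2, hab.2⟩⟩
  · intro x y hxy
    rw [join_adj hne] at hxy
    rw [Finset.mem_union]
    rcases hxy with h | h | ⟨rfl, rfl⟩ | ⟨rfl, rfl⟩
    exacts [Or.inl (h₁.mem x y h), Or.inr (h₂.mem x y h), Or.inl hr, Or.inr hc]
  · have hrx : ∀ x ∈ A₁ ∪ A₂, (G₁.join G₂ r c).Reachable r x := by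
      intro x hx
      rcases Finset.mem_union.1 hx with hx | hx
      · exact (h₁.reachable r hr x hx).mono (le_sup_left.trans le_sup_left)
      · exact (Adj.reachable ((join_adj hne).2 (by simp))).trans
          ((h₂.reachable c hc x hx).mono (le_sup_right.trans le_sup_left))
    exact fun x hx y hy => (hrx x hx).symm.trans (hrx y hy)

theorem IsTreeOn.side_join [Fintype S] (h₁ : G₁.IsTreeOn A₁) (h₂ : G₂.IsTreeOn A₂)
    (hd : Disjoint A₁ A₂) (hr : r ∈ A₁) (hc : c ∈ A₂) :
    (G₁.join G₂ r c).side r c = A₂ := by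
  have hne : r ≠ c := fun h => Finset.disjoint_left.1 hd hr (h ▸ hc)
  ext x
  rw [mem_side]
  constructor
  · intro h
    refine (h.of_closed (H' := G₂) (· ∈ A₂) (fun a b ha hab => ?_) hc).1
    rw [deleteEdges_adj, join_adj hne] at hab
    obtain ⟨h | h | ⟨rfl, rfl⟩ | ⟨rfl, rfl⟩, h'⟩ := hab
    · exact absurd ha (Finset.disjoint_left.1 hd (h₁.mem a b h))
    · exact ⟨h₂.mem_right h, h⟩
    · simp at h'
    · simp [Sym2.eq_swap] at h'
  · intro hx
    refine (h₂.reachable c hc x hx).mono fun a b hab => ?_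
    rw [deleteEdges_adj, join_adj hne]
    refine ⟨Or.inr (Or.inl hab), fun he => ?_⟩
    have ha := h₂.mem a b hab
    have hb := h₂.mem_right hab
    rcases Sym2.eq_iff.1 he with ⟨rfl, rfl⟩ | ⟨rfl, rfl⟩
    · exact Finset.disjoint_left.1 hd hr ha
    · exact Finset.disjoint_left.1 hd hr hb

end Join

end SimpleGraph

end TreeOn

/-! ### Flows on trees and the recursion of rooted trees -/

section Rooted

variable {S : Type u} [Fintype S]

/-- A flow along `G` on `A`: antisymmetric, carried by the edges of `G`, with the net outflow `wt x`
at every vertex `x` of `A` except possibly the root `r`. At every vertex, the flow along each edge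
has the sign of the weight, that is, it runs from black to white vertices. -/
structure IsFlow (wt : S → ℝ) (G : SimpleGraph S) (A : Finset S) (r : S) (f : S → S → ℝ) :
    Prop where
  antisymm : ∀ x y, f y x = -f x y
  eq_zero : ∀ x y, ¬ G.Adj x y → f x y = 0
  sign_eq : ∀ x y, G.Adj x y → SignType.sign (f x y) = SignType.sign (wt x)
  sum_eq : ∀ x ∈ A, x ≠ r → ∑ y, f x y = wt x

/-- `G` is a tree on `A ∋ r` that carries a flow with free root `r`. -/
def IsRootedFlowTree (wt : S → ℝ) (A : Finset S) (r : S) (G : SimpleGraph S) : Prop :=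
  r ∈ A ∧ G.IsTreeOn A ∧ ∃ f, IsFlow wt G A r f

variable [DecidableEq S]

/-- The net outflow of a set of vertices is the flow through its boundary. -/
theorem sum_flow_eq {f : S → S → ℝ} (hf : ∀ x y, f y x = -f x y) (C : Finset S) :
    ∑ x ∈ C, ∑ y, f x y = ∑ x ∈ C, ∑ y ∈ Cᶜ, f x y := by
  have h1 : ∑ x ∈ C, ∑ y ∈ C, f x y = 0 := by
    have h2 : ∑ x ∈ C, ∑ y ∈ C, f x y = ∑ x ∈ C, ∑ y ∈ C, f y x := Finset.sum_comm
    have h3 : ∑ x ∈ C, ∑ y ∈ C, f y x = -∑ x ∈ C, ∑ y ∈ C, f x y := by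
      rw [← Finset.sum_neg_distrib]
      refine Finset.sum_congr rfl fun x _ => ?_
      rw [← Finset.sum_neg_distrib]
      exact Finset.sum_congr rfl fun y _ => hf x y
    linarith
  rw [← zero_add (∑ x ∈ C, ∑ y ∈ Cᶜ, f x y), ← h1, ← Finset.sum_add_distrib]
  exact Finset.sum_congr rfl fun x _ => (Finset.sum_add_sum_compl C _).symm

theorem sum_flow_eq_of_bridge {f : S → S → ℝ} (hf : ∀ x y, f y x = -f x y) {C : Finset S} {r c : S}
    (hc : c ∈ C) (hr : r ∉ C) (h : ∀ x ∈ C, ∀ y ∉ C, f x y ≠ 0 → x = c ∧ y = r) :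
    ∑ x ∈ C, ∑ y, f x y = f c r := by
  rw [sum_flow_eq hf, Finset.sum_eq_single c, Finset.sum_eq_single r]
  · intro y hy hyr
    by_contra h0
    exact hyr (h c hc y (Finset.mem_compl.1 hy) h0).2
  · intro h'; exact absurd (Finset.mem_compl.2 hr) h'
  · intro x hx hxc
    refine Finset.sum_eq_zero fun y hy => ?_
    by_contra h0
    exact hxc (h x hx y (Finset.mem_compl.1 hy) h0).1
  · intro h'; exact absurd hc h'

/-- At the root the net outflow compensates the total weight. -/
theorem IsFlow.sum_root {wt : S → ℝ} {G : SimpleGraph S} {A : Finset S} {r : S} {f : S → S → ℝ}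
    (h : IsFlow wt G A r f) (hG : G.IsTreeOn A) (hr : r ∈ A) :
    ∑ y, f r y = wt r - ∑ x ∈ A, wt x := by
  have h1 : ∑ x ∈ A, ∑ y, f x y = 0 := by
    rw [sum_flow_eq h.antisymm]
    refine Finset.sum_eq_zero fun x _ => Finset.sum_eq_zero fun y hy => h.eq_zero x y fun hxy => ?_
    exact (Finset.mem_compl.1 hy) (hG.mem_right hxy)
  rw [← Finset.add_sum_erase A _ hr] at h1 ⊢
  rw [Finset.sum_congr rfl fun x hx => h.sum_eq x (Finset.mem_of_mem_erase hx)
    (Finset.ne_of_mem_erase hx)] at h1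
  linarith

/-- The flow from `c` to `r` is the total weight on the side of `c`. -/
theorem IsFlow.eq_sum_side {wt : S → ℝ} {G : SimpleGraph S} {A : Finset S} {r r' c : S}
    {f : S → S → ℝ} (h : IsFlow wt G A r' f) (hG : G.IsTreeOn A) (hrc : G.Adj r c)
    (hr' : r' ∉ G.side r c) : f c r = ∑ x ∈ G.side r c, wt x := by
  rw [← sum_flow_eq_of_bridge h.antisymm SimpleGraph.self_mem_side (hG.notMem_side hrc)]
  · exact Finset.sum_congr rfl fun x hx => h.sum_eq x (hG.side_subset hrc hx)
      fun hxr => hr' (hxr ▸ hx)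
  · intro x hx y hy hxy
    refine hG.eq_of_adj_side hrc ?_ hx hy
    by_contra h0
    exact hxy (h.eq_zero x y h0)

/-- A flow restricts to a set that the tree leaves through a single edge, at the new root. -/
theorem IsFlow.restrictTo {wt : S → ℝ} {G : SimpleGraph S} {A C : Finset S} {r c : S}
    {f : S → S → ℝ} (h : IsFlow wt G A r f) (hCA : C ⊆ A) (hr : r ∈ C → r = c)
    (hC : ∀ x ∈ C, ∀ y ∉ C, G.Adj x y → x = c) :
    IsFlow wt (G.restrictTo C) C c fun x y => if x ∈ C ∧ y ∈ C then f x y else 0 where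
  antisymm x y := by
    rw [h.antisymm x y]
    by_cases hx : x ∈ C <;> by_cases hy : y ∈ C <;> simp [hx, hy]
  eq_zero x y hxy := by
    split_ifs with hC
    · exact h.eq_zero x y fun h' => hxy ⟨h', hC⟩
    · rfl
  sign_eq x y hxy := by rw [if_pos hxy.2, h.sign_eq x y hxy.1]
  sum_eq x hx hxc := by
    rw [← h.sum_eq x (hCA hx) fun hxr => hxc (hxr.trans (hr (hxr ▸ hx)))]
    refine Finset.sum_congr rfl fun y _ => ?_
    by_cases hy : y ∈ C
    · rw [if_pos ⟨hx, hy⟩]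
    · rw [if_neg fun h => hy h.2, h.eq_zero x y fun h' => hxc (hC x hx y hy h')]

/-- Two flows glue along a new edge, whose flow is the total weight of the second tree. -/
theorem IsFlow.join {wt : S → ℝ} {G₁ G₂ : SimpleGraph S} {A₁ A₂ : Finset S} {r c : S}
    {f₁ f₂ : S → S → ℝ} (h₁ : IsFlow wt G₁ A₁ r f₁) (h₂ : IsFlow wt G₂ A₂ c f₂)
    (t₁ : G₁.IsTreeOn A₁) (t₂ : G₂.IsTreeOn A₂) (hd : Disjoint A₁ A₂) (hr : r ∈ A₁) (hc : c ∈ A₂)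
    (s₁ : SignType.sign (∑ x ∈ A₂, wt x) = -SignType.sign (wt r))
    (s₂ : SignType.sign (∑ x ∈ A₂, wt x) = SignType.sign (wt c)) :
    IsFlow wt (G₁.join G₂ r c) (A₁ ∪ A₂) r fun x y => f₁ x y + f₂ x y +
      ((if x = c ∧ y = r then ∑ x ∈ A₂, wt x else 0) -
        (if x = r ∧ y = c then ∑ x ∈ A₂, wt x else 0)) := by
  have hne : r ≠ c := fun h => Finset.disjoint_left.1 hd hr (h ▸ hc)
  have z₁ : ∀ x ∈ A₂, ∀ y, f₁ x y = 0 := fun x hx y => h₁.eq_zero x y fun h =>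
    Finset.disjoint_left.1 hd (t₁.mem x y h) hx
  have z₂ : ∀ x ∈ A₁, ∀ y, f₂ x y = 0 := fun x hx y => h₂.eq_zero x y fun h =>
    Finset.disjoint_left.1 hd hx (t₂.mem x y h)
  refine ⟨fun x y => ?_, fun x y hxy => ?_, fun x y hxy => ?_, fun x hx hxr => ?_⟩
  · simp only [h₁.antisymm x y, h₂.antisymm x y, and_comm (a := y = c), and_comm (a := y = r)]
    ring
  · rw [SimpleGraph.join_adj hne] at hxy
    push Not at hxy
    rw [h₁.eq_zero x y hxy.1, h₂.eq_zero x y hxy.2.1, if_neg fun h => hxy.2.2.2 h.1 h.2,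
      if_neg fun h => hxy.2.2.1 h.1 h.2]
    simp
  · rw [SimpleGraph.join_adj hne] at hxy
    rcases hxy with h | h | ⟨rfl, rfl⟩ | ⟨rfl, rfl⟩
    · have hx := t₁.mem x y h
      have hy := t₁.mem_right h
      rw [z₂ x hx y, if_neg, if_neg, ← h₁.sign_eq x y h]
      · simp
      · rintro ⟨-, rfl⟩; exact Finset.disjoint_left.1 hd hy hc
      · rintro ⟨rfl, -⟩; exact Finset.disjoint_left.1 hd hx hc
    · have hx := t₂.mem x y h
      have hy := t₂.mem_right h
      rw [z₁ x hx y, if_neg, if_neg, ← h₂.sign_eq x y h]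
      · simp
      · rintro ⟨rfl, -⟩; exact Finset.disjoint_left.1 hd hr hx
      · rintro ⟨-, rfl⟩; exact Finset.disjoint_left.1 hd hr hy
    · rw [z₂ x hr y, if_neg fun h => hne h.1, if_pos ⟨rfl, rfl⟩, h₁.eq_zero x y fun h =>
        Finset.disjoint_left.1 hd (t₁.mem_right h) hc]
      rw [add_zero, zero_add, zero_sub, Left.sign_neg, s₁, neg_neg]
    · rw [z₁ x hc y, if_pos ⟨rfl, rfl⟩, if_neg fun h => hne h.2, h₂.eq_zero x y fun h =>
        Finset.disjoint_left.1 hd hr (t₂.mem_right h)]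
      rw [add_zero, zero_add, sub_zero, s₂]
  · rw [Finset.sum_add_distrib, Finset.sum_add_distrib, Finset.sum_sub_distrib]
    rcases Finset.mem_union.1 hx with hx | hx
    · have hxc : x ≠ c := fun h => Finset.disjoint_left.1 hd hx (h ▸ hc)
      rw [h₁.sum_eq x hx hxr, Finset.sum_eq_zero fun y _ => z₂ x hx y]
      simp [hxr, hxc]
    · rw [Finset.sum_eq_zero fun y _ => z₁ x hx y]
      by_cases hxc : x = c
      · subst hxc
        rw [h₂.sum_root t₂ hc]
        simp [hxr]
      · rw [h₂.sum_eq x hx hxc]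
        simp [hxr, hxc]

/-- The number of ways to complete `G` to a plane tree on `A` with an extra planted edge at `r`. -/
noncomputable def rootedWeight (A : Finset S) (r : S) (G : SimpleGraph S) : ℕ :=
  (G.neighborSet r).ncard ! * ∏ v ∈ A.erase r, ((G.neighborSet v).ncard - 1)!

open Classical in
/-- The generating series of plane flow trees rooted at `r`. -/
noncomputable def rootedSeries (wt : S → ℝ) (r : S) : SetSeries S := fun A =>
  ∑ G with IsRootedFlowTree wt A r G, (rootedWeight A r G : ℚ)

/-- Deletion of an edge at the root leaves two rooted flow trees. The flow through the edge is the total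
weight of the far side, whence the sign conditions. -/
theorem IsRootedFlowTree.side {wt : S → ℝ} {A : Finset S} {r c : S} {G : SimpleGraph S}
    (h : IsRootedFlowTree wt A r G) (hrc : G.Adj r c) :
    IsRootedFlowTree wt (A \ G.side r c) r (G.restrictTo (A \ G.side r c)) ∧
    IsRootedFlowTree wt (G.side r c) c (G.restrictTo (G.side r c)) ∧
    SignType.sign (∑ x ∈ G.side r c, wt x) = -SignType.sign (wt r) ∧
    SignType.sign (wt c) = -SignType.sign (wt r) := by
  obtain ⟨hr, ht, f, hf⟩ := h
  have hrC := ht.notMem_side hrc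
  refine ⟨⟨Finset.mem_sdiff.2 ⟨hr, hrC⟩, ht.restrictTo_sdiff_side hrc, _,
    hf.restrictTo Finset.sdiff_subset (fun _ => rfl) ?_⟩,
    ⟨SimpleGraph.self_mem_side, ht.restrictTo_side, _,
      hf.restrictTo (ht.side_subset hrc) (fun h => absurd h hrC)
        fun x hx y hy hxy => (ht.eq_of_adj_side hrc hxy hx hy).1⟩, ?_, ?_⟩
  · intro x hx y hy hxy
    rw [Finset.mem_sdiff] at hx hy
    refine (ht.eq_of_adj_side hrc hxy.symm ?_ hx.2).2
    by_contra hy'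
    exact hy ⟨ht.mem_right hxy, hy'⟩
  · rw [← hf.eq_sum_side ht hrc hrC, hf.antisymm r c, Left.sign_neg, hf.sign_eq r c hrc]
  · rw [← hf.sign_eq c r hrc.symm, hf.antisymm r c, Left.sign_neg, hf.sign_eq r c hrc]

theorem IsRootedFlowTree.join {wt : S → ℝ} {A₁ A₂ : Finset S} {r c : S} {G₁ G₂ : SimpleGraph S}
    (h₁ : IsRootedFlowTree wt A₁ r G₁) (h₂ : IsRootedFlowTree wt A₂ c G₂) (hd : Disjoint A₁ A₂)
    (s₁ : SignType.sign (∑ x ∈ A₂, wt x) = -SignType.sign (wt r))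
    (s₂ : SignType.sign (wt c) = -SignType.sign (wt r)) :
    IsRootedFlowTree wt (A₁ ∪ A₂) r (G₁.join G₂ r c) := by
  obtain ⟨hr, t₁, f₁, hf₁⟩ := h₁
  obtain ⟨hc, t₂, f₂, hf₂⟩ := h₂
  exact ⟨Finset.mem_union_left _ hr, t₁.join t₂ hd hr hc, _,
    hf₁.join hf₂ t₁ t₂ hd hr hc s₁ (s₁.trans s₂.symm)⟩

/-- Gluing at an edge `r c` raises the degrees of `r` and `c` by one and keeps the others. -/
theorem rootedWeight_join {A₁ A₂ : Finset S} {r c : S} {G₁ G₂ : SimpleGraph S}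
    (t₁ : G₁.IsTreeOn A₁) (t₂ : G₂.IsTreeOn A₂) (hd : Disjoint A₁ A₂) (hr : r ∈ A₁) (hc : c ∈ A₂) :
    rootedWeight (A₁ ∪ A₂) r (G₁.join G₂ r c) =
      ((G₁.join G₂ r c).neighborSet r).ncard * (rootedWeight A₁ r G₁ * rootedWeight A₂ c G₂) := by
  have hne : r ≠ c := fun h => Finset.disjoint_left.1 hd hr (h ▸ hc)
  have n₁ : ∀ x ∈ A₁, x ≠ r → (G₁.join G₂ r c).neighborSet x = G₁.neighborSet x := by
    intro x hx hxr
    have hxc : x ≠ c := fun h => Finset.disjoint_left.1 hd hx (h ▸ hc)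
    ext y
    rw [SimpleGraph.mem_neighborSet, SimpleGraph.mem_neighborSet, SimpleGraph.join_adj hne]
    have : ¬ G₂.Adj x y := fun h => Finset.disjoint_left.1 hd hx (t₂.mem x y h)
    tauto
  have n₂ : ∀ x ∈ A₂, x ≠ c → (G₁.join G₂ r c).neighborSet x = G₂.neighborSet x := by
    intro x hx hxc
    have hxr : x ≠ r := fun h => Finset.disjoint_left.1 hd (h ▸ hr) hx
    ext y
    rw [SimpleGraph.mem_neighborSet, SimpleGraph.mem_neighborSet, SimpleGraph.join_adj hne]
    have : ¬ G₁.Adj x y := fun h => Finset.disjoint_left.1 hd (t₁.mem x y h) hx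
    tauto
  have nr : ((G₁.join G₂ r c).neighborSet r).ncard = (G₁.neighborSet r).ncard + 1 := by
    rw [← Set.ncard_insert_of_notMem (a := c) (s := G₁.neighborSet r)]
    · congr 1
      ext y
      rw [Set.mem_insert_iff, SimpleGraph.mem_neighborSet, SimpleGraph.mem_neighborSet,
        SimpleGraph.join_adj hne]
      have : ¬ G₂.Adj r y := fun h => Finset.disjoint_left.1 hd hr (t₂.mem r y h)
      tauto
    · exact fun h => Finset.disjoint_left.1 hd (t₁.mem_right h) hc
  have nc : ((G₁.join G₂ r c).neighborSet c).ncard = (G₂.neighborSet c).ncard + 1 := by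
    rw [← Set.ncard_insert_of_notMem (a := r) (s := G₂.neighborSet c)]
    · congr 1
      ext y
      rw [Set.mem_insert_iff, SimpleGraph.mem_neighborSet, SimpleGraph.mem_neighborSet,
        SimpleGraph.join_adj hne]
      have : ¬ G₁.Adj c y := fun h => Finset.disjoint_left.1 hd (t₁.mem c y h) hc
      tauto
    · exact fun h => Finset.disjoint_left.1 hd hr (t₂.mem_right h)
  have he : (A₁ ∪ A₂).erase r = A₁.erase r ∪ A₂ := by
    rw [Finset.erase_union_distrib, Finset.erase_eq_of_notMem (Finset.disjoint_left.1 hd hr)]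
  rw [rootedWeight, rootedWeight, rootedWeight, he, Finset.prod_union
    (Finset.disjoint_of_subset_left (Finset.erase_subset _ _) hd), ← Finset.mul_prod_erase A₂ _ hc,
    nr, nc, Nat.factorial_succ, Nat.add_sub_cancel,
    Finset.prod_congr rfl fun x hx => by
      rw [n₁ x (Finset.mem_of_mem_erase hx) (Finset.ne_of_mem_erase hx)],
    Finset.prod_congr (s₁ := A₂.erase c) rfl fun x hx => by
      rw [n₂ x (Finset.mem_of_mem_erase hx) (Finset.ne_of_mem_erase hx)]]
  ring


open Classical in
/-- The only rooted tree whose root has degree zero is the single vertex. -/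
theorem sum_rootedWeight_of_degree_eq_zero (wt : S → ℝ) (A : Finset S) (r : S) :
    (∑ G with IsRootedFlowTree wt A r G, if (G.neighborSet r).ncard = 0 then
      (rootedWeight A r G : ℚ) else 0) = SetSeries.delta {r} A := by
  rw [SetSeries.delta]
  split_ifs with hA
  · subst hA
    have h1 : ∀ G : SimpleGraph S, IsRootedFlowTree wt {r} r G ↔ G = ⊥ := by
      intro G
      constructor
      · rintro ⟨-, ht, -⟩
        ext x y
        simp only [SimpleGraph.bot_adj, iff_false]
        intro h
        have hx := Finset.mem_singleton.1 (ht.mem x y h)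
        have hy := Finset.mem_singleton.1 (ht.mem_right h)
        exact h.ne (hx.trans hy.symm)
      · rintro rfl
        refine ⟨Finset.mem_singleton_self r, ⟨SimpleGraph.isAcyclic_bot, fun _ _ h => h.elim, ?_⟩,
          0, fun _ _ => by simp, fun _ _ _ => rfl, fun _ _ h => h.elim, ?_⟩
        · intro x hx y hy
          rw [Finset.mem_singleton.1 hx, Finset.mem_singleton.1 hy]
        · intro x hx hxr
          exact absurd (Finset.mem_singleton.1 hx) hxr
    rw [Finset.sum_eq_single_of_mem ⊥ (Finset.mem_filter.2 ⟨Finset.mem_univ _, (h1 ⊥).2 rfl⟩)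
      fun G hG hne => absurd ((h1 G).1 (Finset.mem_filter.1 hG).2) hne]
    simp [rootedWeight]
  · refine Finset.sum_eq_zero fun G hG => if_neg fun h0 => hA ?_
    obtain ⟨hr, ht, -⟩ := (Finset.mem_filter.1 hG).2
    rw [Set.ncard_eq_zero] at h0
    refine Finset.eq_singleton_iff_unique_mem.2 ⟨hr, fun x hx => ?_⟩
    refine ((ht.reachable r hr x hx).of_closed (H' := G) (· = r) (fun a b ha hab => ?_) rfl).1
    subst ha
    have : b ∈ G.neighborSet a := hab
    rw [h0] at this
    exact this.elim

/-- A rooted tree is a single vertex or has a first branch at the root: deletion of the edge `r c`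
leaves a smaller tree rooted at `r` and a tree rooted at `c`. -/
theorem rootedSeries_eq (wt : S → ℝ) (r : S) :
    rootedSeries wt r = SetSeries.delta {r} +
      rootedSeries wt r * SetSeries.cut wt (-SignType.sign (wt r))
        (∑ c, if SignType.sign (wt c) = -SignType.sign (wt r) then rootedSeries wt c else 0) := by
  classical
  ext A
  -- Since `d! = d * (d - 1)!`, the weight of a tree with root degree `d ≠ 0` is shared equally
  -- among the edges at the root.
  have hsplit : rootedSeries wt r A = SetSeries.delta {r} A +
      ∑ p : SimpleGraph S × S with IsRootedFlowTree wt A r p.1 ∧ p.1.Adj r p.2,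
        (rootedWeight A r p.1 : ℚ) / (p.1.neighborSet r).ncard := by
    rw [← sum_rootedWeight_of_degree_eq_zero wt A r, Finset.sum_filter, Finset.sum_filter,
      Fintype.sum_prod_type, ← Finset.sum_add_distrib, rootedSeries, Finset.sum_filter]
    refine Finset.sum_congr rfl fun G _ => ?_
    by_cases hG : IsRootedFlowTree wt A r G
    · simp only [hG, true_and, if_true]
      rw [← Finset.sum_filter, Finset.sum_const, nsmul_eq_mul]
      have hc : (Finset.univ.filter fun c => G.Adj r c).card = (G.neighborSet r).ncard := by
        rw [← Set.ncard_coe_finset]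
        congr 1
        ext; simp
      rw [hc]
      by_cases h0 : (G.neighborSet r).ncard = 0
      · simp [h0]
      · have : ((G.neighborSet r).ncard : ℚ) ≠ 0 := by exact_mod_cast h0
        rw [if_neg h0, mul_div_cancel₀ _ this, zero_add]
    · simp [hG]
  have hright : (rootedSeries wt r * SetSeries.cut wt (-SignType.sign (wt r))
        (∑ c, if SignType.sign (wt c) = -SignType.sign (wt r) then rootedSeries wt c else 0)) A =
      ∑ q : Finset S × S × SimpleGraph S × SimpleGraph S with (q.1 ⊆ A ∧
          SignType.sign (∑ x ∈ q.1, wt x) = -SignType.sign (wt r)) ∧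
          SignType.sign (wt q.2.1) = -SignType.sign (wt r) ∧
          IsRootedFlowTree wt q.1 q.2.1 q.2.2.2 ∧ IsRootedFlowTree wt (A \ q.1) r q.2.2.1,
        (rootedWeight (A \ q.1) r q.2.2.1 : ℚ) * rootedWeight q.1 q.2.1 q.2.2.2 := by
    have hp : A.powerset = Finset.univ.filter (· ⊆ A) := by ext; simp
    rw [SetSeries.mul_comm, SetSeries.mul_apply, hp, Finset.sum_filter, Finset.sum_filter,
      Fintype.sum_prod_type]
    refine Finset.sum_congr rfl fun C _ => ?_
    rw [SetSeries.cut_apply, SetSeries.wsign]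
    by_cases hC : C ⊆ A ∧ SignType.sign (∑ x ∈ C, wt x) = -SignType.sign (wt r)
    swap
    · rw [Finset.sum_eq_zero (s := (Finset.univ : Finset (S × SimpleGraph S × SimpleGraph S)))
        fun q _ => if_neg fun h => hC h.1]
      by_cases hCA : C ⊆ A
      · rw [if_pos hCA, if_neg fun h => hC ⟨hCA, h⟩, zero_mul]
      · rw [if_neg hCA]
    simp only [hC, true_and, if_true]
    rw [SetSeries.sum_apply, Finset.sum_mul, Fintype.sum_prod_type]
    refine Finset.sum_congr rfl fun c _ => ?_
    by_cases hc : SignType.sign (wt c) = -SignType.sign (wt r)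
    swap
    · simp [hc]
    simp only [hc, true_and, if_true]
    rw [mul_comm, rootedSeries, rootedSeries, Finset.sum_mul_sum, ← Finset.sum_product',
      ← Finset.sum_filter]
    refine Finset.sum_congr ?_ fun _ _ => rfl
    ext ⟨G₁, G₂⟩
    simp [and_comm]
  rw [SetSeries.add_apply, hsplit, hright]
  congr 1
  refine Finset.sum_bij' (fun p _ => (p.1.side r p.2, p.2, p.1.restrictTo (A \ p.1.side r p.2),
    p.1.restrictTo (p.1.side r p.2))) (fun q _ => (q.2.2.1.join q.2.2.2 r q.2.1, q.2.1))
    ?_ ?_ ?_ ?_ ?_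
  · rintro ⟨G, c⟩ hp
    obtain ⟨hG, hrc⟩ := (Finset.mem_filter.1 hp).2
    obtain ⟨h1, h2, h3, h4⟩ := hG.side hrc
    exact Finset.mem_filter.2 ⟨Finset.mem_univ _, ⟨hG.2.1.side_subset hrc, h3⟩, h4, h2, h1⟩
  · rintro ⟨C, c, G₁, G₂⟩ hq
    obtain ⟨⟨hCA, h3⟩, h4, h2, h1⟩ := (Finset.mem_filter.1 hq).2
    have hj := h1.join h2 Finset.sdiff_disjoint h3 h4
    dsimp only at hCA hj
    rw [Finset.sdiff_union_of_subset hCA] at hj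
    refine Finset.mem_filter.2 ⟨Finset.mem_univ _, hj, ?_⟩
    rw [SimpleGraph.join_adj]
    · simp
    · rintro rfl
      exact (Finset.mem_sdiff.1 h1.1).2 h2.1
  · rintro ⟨G, c⟩ hp
    obtain ⟨hG, hrc⟩ := (Finset.mem_filter.1 hp).2
    exact Prod.ext (hG.2.1.join_restrictTo hrc) rfl
  · rintro ⟨C, c, G₁, G₂⟩ hq
    obtain ⟨⟨hCA, h3⟩, h4, ⟨hc, t₂, -⟩, hr, t₁, -⟩ := (Finset.mem_filter.1 hq).2
    dsimp only at *
    rw [t₁.side_join t₂ Finset.sdiff_disjoint hr hc,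
      t₁.restrictTo_join_left t₂ Finset.sdiff_disjoint hr hc,
      t₁.restrictTo_join_right t₂ Finset.sdiff_disjoint hr hc]
  · rintro ⟨G, c⟩ hp
    obtain ⟨hG, hrc⟩ := (Finset.mem_filter.1 hp).2
    obtain ⟨⟨hr, t₁, -⟩, ⟨hc, t₂, -⟩, -, -⟩ := hG.side hrc
    have hw := rootedWeight_join t₁ t₂ Finset.sdiff_disjoint hr hc
    dsimp only at hG hrc ⊢
    rw [hG.2.1.join_restrictTo hrc, Finset.sdiff_union_of_subset (hG.2.1.side_subset hrc)] at hw
    have h0 : ((G.neighborSet r).ncard : ℚ) ≠ 0 := by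
      rw [Nat.cast_ne_zero, ← Nat.pos_iff_ne_zero, Set.ncard_pos]
      exact ⟨c, hrc⟩
    rw [hw, Nat.cast_mul, mul_div_cancel_left₀ _ h0, Nat.cast_mul]

/-- The generating series of plane flow trees with a root of sign `σ`. -/
noncomputable def signedSeries (wt : S → ℝ) (σ : SignType) : SetSeries S :=
  ∑ r, if SignType.sign (wt r) = σ then rootedSeries wt r else 0

theorem signedSeries_eq (wt : S → ℝ) (σ : SignType) :
    signedSeries wt σ = SetSeries.cut wt σ SetSeries.singles +
      signedSeries wt σ * SetSeries.cut wt (-σ) (signedSeries wt (-σ)) := by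
  have h1 : SetSeries.cut wt σ SetSeries.singles =
      ∑ r, if SignType.sign (wt r) = σ then SetSeries.delta {r} else 0 := by
    ext A
    rw [SetSeries.sum_apply, SetSeries.cut_apply, SetSeries.singles]
    by_cases hA : A.card = 1
    · obtain ⟨s, rfl⟩ := Finset.card_eq_one.1 hA
      rw [Finset.sum_eq_single s]
      · by_cases h : SignType.sign (wt s) = σ <;> simp [SetSeries.wsign, SetSeries.delta, h]
      · intro r _ hr
        split_ifs
        · exact if_neg fun h => hr (Finset.singleton_injective h).symm
        · rfl
      · simp
    · rw [if_neg hA, ite_self, Finset.sum_eq_zero]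
      intro r _
      split_ifs
      · refine if_neg fun h => hA ?_
        rw [h, Finset.card_singleton]
      · rfl
  rw [h1]
  generalize hu : signedSeries wt (-σ) = u
  rw [signedSeries, Finset.sum_mul, ← Finset.sum_add_distrib]
  refine Finset.sum_congr rfl fun r _ => ?_
  split_ifs with h
  · subst h hu
    exact rootedSeries_eq wt r
  · rw [zero_mul, add_zero]

end Rooted

/-! ### Flow trees on the whole vertex set -/

section FlowTree

variable {S : Type u} [Fintype S]

/-- `G` is a tree on all of `S` that carries a flow with net outflow `wt x` at every vertex `x`.
Quantifying over the root `r` leaves no vertex exempt, as soon as `S` has two elements. -/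
def IsFlowTree (wt : S → ℝ) (G : SimpleGraph S) : Prop :=
  G.IsTree ∧ ∃ f, ∀ r, IsFlow wt G Finset.univ r f

theorem SimpleGraph.IsTree.isTreeOn_univ {G : SimpleGraph S} (h : G.IsTree) :
    G.IsTreeOn Finset.univ :=
  ⟨h.isAcyclic, fun _ _ _ => Finset.mem_univ _, fun x _ y _ => h.connected.preconnected x y⟩

theorem IsFlow.sign_eq_neg {wt : S → ℝ} {G : SimpleGraph S} {A : Finset S} {r : S}
    {f : S → S → ℝ} (hf : IsFlow wt G A r f) {x y : S} (h : G.Adj x y) :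
    SignType.sign (wt y) = -SignType.sign (wt x) := by
  rw [← hf.sign_eq x y h, ← hf.sign_eq y x h.symm, hf.antisymm x y, Left.sign_neg]

/-- Every edge has exactly one black end, so the black degrees add up to the number of edges. -/
theorem IsFlowTree.sum_degree {wt : S → ℝ} (h0 : ∀ s, wt s ≠ 0) {G : SimpleGraph S}
    (hG : IsFlowTree wt G) :
    ∑ r with SignType.sign (wt r) = 1, (G.neighborSet r).ncard + 1 = Fintype.card S := by
  classical
  obtain ⟨ht, f, hf⟩ := hG
  have hb : G.IsBipartiteWith (Finset.univ.filter fun r => SignType.sign (wt r) = 1 : Finset S)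
      (Finset.univ.filter fun r => SignType.sign (wt r) = -1 : Finset S) := by
    refine ⟨?_, fun x y h => ?_⟩
    · rw [Finset.disjoint_coe, Finset.disjoint_filter]
      intro x _ h1 h2
      rw [h1] at h2
      exact absurd h2 (by decide)
    · have h1 := (hf x).sign_eq_neg h
      rcases lt_or_gt_of_ne (h0 x) with hx | hx
      · right; simp_all
      · left; simp_all
  rw [← ht.card_edgeFinset, ← SimpleGraph.isBipartiteWith_sum_degrees_eq_card_edges hb]
  congr 1
  refine Finset.sum_congr rfl fun x _ => ?_
  rw [Set.ncard_eq_toFinset_card', SimpleGraph.degree, SimpleGraph.neighborFinset]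

variable [DecidableEq S]

/-- When the total weight is zero, the condition at the root holds automatically. -/
theorem isRootedFlowTree_univ_iff {wt : S → ℝ} (hsum : ∑ s, wt s = 0) {r : S}
    {G : SimpleGraph S} : IsRootedFlowTree wt Finset.univ r G ↔ IsFlowTree wt G := by
  constructor
  · rintro ⟨hr, ht, f, hf⟩
    have : Nonempty S := ⟨r⟩
    refine ⟨⟨⟨fun x y => ht.reachable x (Finset.mem_univ x) y (Finset.mem_univ y)⟩, ht.acyclic⟩, f,
      fun r' => ⟨hf.antisymm, hf.eq_zero, hf.sign_eq, fun x hx _ => ?_⟩⟩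
    by_cases hxr : x = r
    · rw [hxr, hf.sum_root ht hr, hsum, sub_zero]
    · exact hf.sum_eq x hx hxr
  · rintro ⟨ht, f, hf⟩
    exact ⟨Finset.mem_univ r, ht.isTreeOn_univ, f, hf r⟩

/-- A flow on a tree is unique. -/
theorem IsFlow.unique {wt : S → ℝ} {G : SimpleGraph S} {f g : S → S → ℝ} (ht : G.IsTree)
    (hf : ∀ r, IsFlow wt G Finset.univ r f) (hg : ∀ r, IsFlow wt G Finset.univ r g) (x y : S) :
    f x y = g x y := by
  by_cases h : G.Adj y x
  · have h0 := ht.isTreeOn_univ.notMem_side h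
    rw [(hf y).eq_sum_side ht.isTreeOn_univ h h0, (hg y).eq_sum_side ht.isTreeOn_univ h h0]
  · rw [(hf y).eq_zero x y fun h' => h h'.symm, (hg y).eq_zero x y fun h' => h h'.symm]

open Classical in
/-- On the full set the series counts plane flow trees with a marked edge, namely the first edge at its
black end. -/
theorem signedSeries_univ {wt : S → ℝ} (h0 : ∀ s, wt s ≠ 0) (hsum : ∑ s, wt s = 0) :
    signedSeries wt 1 Finset.univ = ((Fintype.card S : ℚ) - 1) *
      ∑ G with IsFlowTree wt G, ∏ v, (((G.neighborSet v).ncard - 1)! : ℚ) := by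
  -- Planting a root at `r` replaces the factor `(deg r - 1)!` by `(deg r)!`.
  have h1 : ∀ r, rootedSeries wt r Finset.univ = ∑ G with IsFlowTree wt G,
      ((G.neighborSet r).ncard : ℚ) * ∏ v, (((G.neighborSet v).ncard - 1)! : ℚ) := by
    intro r
    rw [rootedSeries]
    refine Finset.sum_congr (by ext G; simp [isRootedFlowTree_univ_iff hsum]) fun G hG => ?_
    have hnt : Nontrivial S := by
      by_contra h
      rw [not_nontrivial_iff_subsingleton] at h
      rw [Fintype.sum_subsingleton _ r] at hsum
      exact h0 r hsum
    have hpos : (G.neighborSet r).ncard ≠ 0 := by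
      rw [Set.ncard_eq_toFinset_card', ← SimpleGraph.neighborFinset,
        SimpleGraph.card_neighborFinset_eq_degree]
      exact ((Finset.mem_filter.1 hG).2.1.connected.preconnected.degree_pos_of_nontrivial r).ne'
    rw [rootedWeight, ← Finset.mul_prod_erase Finset.univ _ (Finset.mem_univ r)]
    rw [← mul_assoc, ← Nat.mul_factorial_pred hpos]
    push_cast
    rfl
  rw [signedSeries, SetSeries.sum_apply, Finset.mul_sum]
  have h2 : ∀ r, (if SignType.sign (wt r) = 1 then rootedSeries wt r else 0) Finset.univ =
      if SignType.sign (wt r) = 1 then rootedSeries wt r Finset.univ else 0 := by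
    intro r; split_ifs <;> rfl
  rw [Finset.sum_congr rfl fun r _ => h2 r, ← Finset.sum_filter,
    Finset.sum_congr rfl fun r _ => h1 r, Finset.sum_comm]
  refine Finset.sum_congr rfl fun G hG => ?_
  rw [← Finset.sum_mul, ← IsFlowTree.sum_degree h0 (Finset.mem_filter.1 hG).2]
  push_cast
  ring

end FlowTree

/-- The number of cyclic orders of a finite set. -/
theorem card_cyclic_perm (α : Type*) [Finite α] :
    Nat.card {π : Equiv.Perm α // ∀ a b, π.SameCycle a b} = (Nat.card α - 1)! := by
  classical
  have := Fintype.ofFinite α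
  rw [Nat.card_eq_fintype_card (α := α)]
  by_cases h : 2 ≤ Fintype.card α
  · have h1 : ∀ π : Equiv.Perm α, (∀ a b, π.SameCycle a b) ↔
        π.cycleType = {Fintype.card α} := by
      intro π
      constructor
      · intro hπ
        have hnt : Nontrivial α := Fintype.one_lt_card_iff_nontrivial.1 h
        have hm : ∀ x, π x ≠ x := by
          intro x hx
          obtain ⟨y, hy⟩ := exists_ne x
          obtain ⟨k, hk⟩ := hπ x y
          rw [Equiv.Perm.zpow_apply_eq_self_of_apply_eq_self hx] at hk
          exact hy hk.symm
        obtain ⟨x⟩ := hnt.to_nonempty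
        have hc : π.IsCycle := (Equiv.Perm.isCycle_iff_sameCycle (hm x)).2
          fun {y} => ⟨fun _ => hm y, fun _ => hπ x y⟩
        rw [hc.cycleType]
        have : π.support = Finset.univ := by
          ext y; simp [hm y]
        rw [this, Finset.card_univ]
      · intro hπ a b
        have hc : π.IsCycle := Equiv.Perm.card_cycleType_eq_one.1 (by rw [hπ]; rfl)
        have hs : π.support = Finset.univ := by
          have := hc.cycleType
          rw [hπ, Multiset.singleton_inj] at this
          exact (Finset.card_eq_iff_eq_univ _).1 this.symm
        have hm : ∀ x, π x ≠ x := fun x => by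
          rw [← Equiv.Perm.mem_support, hs]; exact Finset.mem_univ x
        exact hc.sameCycle (hm a) (hm b)
    rw [Nat.card_congr (Equiv.subtypeEquivRight h1), Nat.card_eq_fintype_card,
      Fintype.card_subtype, Equiv.Perm.card_of_cycleType_singleton h le_rfl, Nat.choose_self,
      mul_one]
  · have hs : Subsingleton α := Fintype.card_le_one_iff_subsingleton.1 (by omega)
    have : Fintype.card α - 1 = 0 := by omega
    rw [this, Nat.factorial_zero, Nat.card_eq_one_iff_unique]
    exact ⟨inferInstance, ⟨1, fun a b => Subsingleton.elim a b ▸ .rfl⟩⟩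

/-- The sum of the edge weights at `v`, as a sum over the neighbors of `v`. -/
theorem WBPTree.edgeSum_eq {V : Type u} (T : WBPTree V) (v : V) :
    T.edgeSum v = ∑ᶠ y : T.graph.neighborSet v, T.edgeWeight ⟨s(v, y), y.2⟩ := by
  have hinj : Function.Injective fun y : T.graph.neighborSet v =>
      (⟨s(v, y), y.2⟩ : T.graph.edgeSet) := by
    intro y z h
    exact Subtype.ext (Sym2.congr_right.1 (Subtype.ext_iff.1 h))
  rw [← finsum_mem_range hinj, WBPTree.edgeSum]
  refine finsum_congr fun e => ?_
  have : v ∈ (e : Sym2 V) ↔ e ∈ Set.range fun y : T.graph.neighborSet v =>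
      (⟨s(v, y), y.2⟩ : T.graph.edgeSet) := by
    constructor
    · obtain ⟨e, he⟩ := e
      intro hv
      obtain ⟨y, rfl⟩ := hv
      exact ⟨⟨y, he⟩, rfl⟩
    · rintro ⟨y, rfl⟩
      exact Sym2.mem_mk_left v y
  rw [this]

/-! ### Isomorphism classes of labeled trees -/

theorem finsum_coe_eq_sum {α : Type*} [Fintype α] (s : Set α) (g : α → ℝ)
    (hg : ∀ x ∉ s, g x = 0) : ∑ᶠ y : s, g y = ∑ y, g y := by
  classical
  rw [finsum_eq_sum_of_fintype, ← Finset.sum_subtype s.toFinset (by simp) g]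
  exact Finset.sum_subset (Finset.subset_univ _) fun x _ hx => hg x (by simpa using hx)

section Realize

variable {S : Type u} [Fintype S] {wt : S → ℝ}

/-- The cyclic rotation systems of `G`: an anticlockwise cyclic order of the edges at each vertex. -/
abbrev Rotations (G : SimpleGraph S) : Type u :=
  ∀ v, {π : Equiv.Perm (G.neighborSet v) // ∀ a b, π.SameCycle a b}

/-- The flow of a flow tree. -/
noncomputable def IsFlowTree.flow {G : SimpleGraph S} (hG : IsFlowTree wt G) : S → S → ℝ :=
  hG.2.choose

theorem IsFlowTree.isFlow_flow {G : SimpleGraph S} (hG : IsFlowTree wt G) (r : S) :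
    IsFlow wt G Finset.univ r hG.flow := hG.2.choose_spec r

/-- The weighted plane tree of a flow tree with a rotation system; the weight of an edge is the
absolute value of the flow. -/
noncomputable def IsFlowTree.toPlaneTree (h0 : ∀ s, wt s ≠ 0) {G : SimpleGraph S}
    (hG : IsFlowTree wt G) (π : Rotations G) : WBPTree S where
  graph := G
  isTree := hG.1
  black := {v | 0 < wt v}
  bicolored v w h := by
    have h1 := (hG.isFlow_flow v).sign_eq_neg h
    rcases lt_or_gt_of_ne (h0 v) with hv | hv <;> rcases lt_or_gt_of_ne (h0 w) with hw | hw <;>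
      simp_all [not_lt.2, le_of_lt]
  next v := (π v).1
  next_cyclic v := (π v).2
  edgeWeight e := Sym2.lift ⟨fun x y => |hG.flow x y|, fun x y => by
    simp only [(hG.isFlow_flow x).antisymm y x, abs_neg]⟩ e
  edgeWeight_pos := by
    rintro ⟨e, he⟩
    induction e using Sym2.ind with
    | _ x y =>
      refine abs_pos.2 fun h => h0 x ?_
      have h1 := (hG.isFlow_flow x).sign_eq x y he
      rw [h, sign_zero] at h1
      exact sign_eq_zero_iff.1 h1.symm

theorem IsFlowTree.vertexWeight_toPlaneTree [Nontrivial S] (h0 : ∀ s, wt s ≠ 0)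
    {G : SimpleGraph S} (hG : IsFlowTree wt G) (π : Rotations G) (v : S) :
    (hG.toPlaneTree h0 π).vertexWeight v = wt v := by
  obtain ⟨r, hr⟩ := exists_ne v
  have hf := hG.isFlow_flow r
  have h1 : (hG.toPlaneTree h0 π).edgeSum v = ∑ y, |hG.flow v y| := by
    rw [WBPTree.edgeSum_eq]
    refine Eq.trans ?_ (finsum_coe_eq_sum (G.neighborSet v) _ fun y hy => ?_)
    · rfl
    · rw [hf.eq_zero v y hy, abs_zero]
  have h2 := hf.sum_eq v (Finset.mem_univ v) hr.symm
  rw [WBPTree.vertexWeight, h1]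
  change (if 0 < wt v then _ else _) = _
  rcases lt_or_gt_of_ne (h0 v) with hv | hv
  · rw [if_neg (not_lt.2 hv.le), ← h2, ← Finset.sum_neg_distrib]
    refine Finset.sum_congr rfl fun y _ => ?_
    by_cases h : G.Adj v y
    · have h3 := hf.sign_eq v y h
      rw [sign_neg hv, sign_eq_neg_one_iff] at h3
      rw [abs_of_neg h3, neg_neg]
    · rw [hf.eq_zero v y h, abs_zero, neg_zero]
  · rw [if_pos hv, ← h2]
    refine Finset.sum_congr rfl fun y _ => ?_
    by_cases h : G.Adj v y
    · have h3 := hf.sign_eq v y h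
      rw [sign_pos hv, sign_eq_one_iff] at h3
      rw [abs_of_pos h3]
    · rw [hf.eq_zero v y h, abs_zero]

end Realize

section Quotient

variable {S : Type u} [Fintype S] {Ξ : Passport S}

theorem Passport.IsFull.sum_wt (hΞ : Ξ.IsFull) : ∑ s, Ξ.wt s = 0 := by
  rw [← Ξ.sum_eq_zero]
  exact Finset.sum_congr rfl fun s _ => by rw [hΞ s, Nat.cast_one, one_mul]

theorem Passport.IsFull.nontrivial (hΞ : Ξ.IsFull) : Nontrivial S := by
  by_contra h
  rw [not_nontrivial_iff_subsingleton] at h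
  obtain ⟨s⟩ := Ξ.nonempty
  have := hΞ.sum_wt
  rw [Fintype.sum_subsingleton _ s] at this
  exact Ξ.wt_ne_zero s this

/-- Plane flow trees on `S` itself: a graph and a rotation system. -/
abbrev PlaneFlowTree (wt : S → ℝ) : Type u :=
  Σ G : {G : SimpleGraph S // IsFlowTree wt G}, Rotations G.1

/-- A plane flow tree on `S`, labeled by the identity. -/
noncomputable def PlaneFlowTree.toLWBPTree (hΞ : Ξ.IsFull) (i : PlaneFlowTree Ξ.wt) :
    LWBPTree Ξ where
  V := S
  finite := inferInstance
  tree := i.1.2.toPlaneTree Ξ.wt_ne_zero i.2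
  lab := id
  lab_surjective := Function.surjective_id
  wt_lab v := by
    have := hΞ.nontrivial
    exact (i.1.2.vertexWeight_toPlaneTree Ξ.wt_ne_zero i.2 v).symm
  card_fiber s := by
    rw [hΞ s, Nat.card_eq_one_iff_unique]
    exact ⟨⟨fun a b => Subtype.ext (a.2.trans b.2.symm)⟩, ⟨s, rfl⟩⟩

/-- The labels force an isomorphism between trees on `S` to be the identity. -/
theorem PlaneFlowTree.toLWBPTree_injective (hΞ : Ξ.IsFull) {i j : PlaneFlowTree Ξ.wt}
    (h : (i.toLWBPTree hΞ).Isomorphic (j.toLWBPTree hΞ)) : i = j := by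
  obtain ⟨⟨G, hG⟩, π⟩ := i
  obtain ⟨⟨G', hG'⟩, π'⟩ := j
  obtain ⟨f, -, hn, -, hl⟩ := h
  change G ≃g G' at f
  replace hl : ∀ v, f v = v := hl
  have hGG : G = G' := by
    ext x y
    have := f.map_adj_iff (v := x) (w := y)
    rw [hl, hl] at this
    exact this.symm
  subst hGG
  congr 1
  funext v
  refine Subtype.ext (Equiv.ext fun a => Subtype.ext ?_)
  have key : ∀ (w : S) (_ : w = v) (b : G.neighborSet w), (b : S) = a →
      (((π' w).1 b : G.neighborSet w) : S) = (π' v).1 a := by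
    rintro w rfl b hb
    rw [Subtype.ext hb]
  have h1 : f ((π v).1 a) = ((π' (f v)).1 (f.mapNeighborSet v a) : S) :=
    congrArg Subtype.val (hn v a)
  rw [hl] at h1
  rw [h1]
  exact key _ (hl v) _ (hl a)

theorem LWBPTree.lab_bijective (hΞ : Ξ.IsFull) (T : LWBPTree Ξ) : Function.Bijective T.lab := by
  refine ⟨fun v w h => ?_, T.lab_surjective⟩
  have h1 := T.card_fiber (T.lab w)
  rw [hΞ, Nat.card_eq_one_iff_unique] at h1
  exact congrArg Subtype.val (h1.1.elim ⟨v, h⟩ ⟨w, rfl⟩)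

/-- Edge weights are positive, so the black vertices are those of positive weight. -/
theorem LWBPTree.mem_black_iff (T : LWBPTree Ξ) (v : T.V) :
    v ∈ T.tree.black ↔ 0 < Ξ.wt (T.lab v) := by
  have h1 : 0 ≤ T.tree.edgeSum v :=
    finsum_nonneg fun e => finsum_nonneg fun _ => (T.tree.edgeWeight_pos e).le
  have h0 := Ξ.wt_ne_zero (T.lab v)
  rw [T.wt_lab, WBPTree.vertexWeight] at *
  split_ifs at * with h
  · exact ⟨fun _ => h1.lt_of_ne h0.symm, fun _ => h⟩
  · exact ⟨fun h' => absurd h' h, fun h' => by linarith⟩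

open Classical in
/-- The flow of a weighted tree: the edge weight, signed by the color of the source. -/
noncomputable def WBPTree.flow {V : Type u} (T : WBPTree V) (x y : V) : ℝ :=
  if h : T.graph.Adj x y then
    if x ∈ T.black then T.edgeWeight ⟨s(x, y), h⟩ else -T.edgeWeight ⟨s(x, y), h⟩
  else 0

theorem WBPTree.flow_antisymm {V : Type u} (T : WBPTree V) (x y : V) :
    T.flow y x = -T.flow x y := by
  by_cases h : T.graph.Adj x y
  · have h1 := T.bicolored x y h
    have h2 : (⟨s(y, x), h.symm⟩ : T.graph.edgeSet) = ⟨s(x, y), h⟩ := Subtype.ext Sym2.eq_swap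
    rw [flow, flow, dif_pos h, dif_pos h.symm, h2]
    by_cases hx : x ∈ T.black
    · rw [if_pos hx, if_neg (h1.1 hx)]
    · rw [if_neg hx, if_pos (by tauto), neg_neg]
  · rw [flow, flow, dif_neg h, dif_neg fun h' => h h'.symm, neg_zero]

theorem WBPTree.abs_flow {V : Type u} (T : WBPTree V) {x y : V} (h : T.graph.Adj x y) :
    |T.flow x y| = T.edgeWeight ⟨s(x, y), h⟩ := by
  rw [flow, dif_pos h]
  split_ifs
  · exact abs_of_pos (T.edgeWeight_pos _)
  · rw [abs_neg]; exact abs_of_pos (T.edgeWeight_pos _)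

theorem WBPTree.sum_flow {V : Type u} [Fintype V] (T : WBPTree V) (x : V) :
    ∑ y, T.flow x y = T.vertexWeight x := by
  rw [← finsum_coe_eq_sum (T.graph.neighborSet x) (T.flow x) fun y hy => dif_neg hy, vertexWeight,
    edgeSum_eq]
  split_ifs with hx
  · exact finsum_congr fun y => by rw [flow, dif_pos (show T.graph.Adj x y from y.2), if_pos hx]
  · rw [← finsum_neg_distrib]
    exact finsum_congr fun y => by rw [flow, dif_pos (show T.graph.Adj x y from y.2), if_neg hx]

/-- Transport along the labels turns every labeled tree into a plane flow tree on `S`. -/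
theorem LWBPTree.exists_isomorphic (hΞ : Ξ.IsFull) (T : LWBPTree Ξ) :
    ∃ i : PlaneFlowTree Ξ.wt, (i.toLWBPTree hΞ).Isomorphic T := by
  classical
  have := T.finite
  have := Fintype.ofFinite T.V
  let e : S ≃ T.V := (Equiv.ofBijective T.lab (T.lab_bijective hΞ)).symm
  have he' : ∀ s, T.lab (e s) = s := (Equiv.ofBijective T.lab _).apply_symm_apply
  let G : SimpleGraph S := T.tree.graph.comap e
  let F : G ≃g T.tree.graph := SimpleGraph.Iso.comap e T.tree.graph
  have hf : ∀ r, IsFlow Ξ.wt G Finset.univ r fun x y => T.tree.flow (e x) (e y) := by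
    refine fun r => ⟨fun x y => T.tree.flow_antisymm _ _, fun x y h => dif_neg h,
      fun x y h => ?_, fun x _ _ => ?_⟩
    · have hb := T.mem_black_iff (e x)
      rw [he'] at hb
      have hp := T.tree.edgeWeight_pos ⟨s(e x, e y), h⟩
      rw [WBPTree.flow, dif_pos (show T.tree.graph.Adj (e x) (e y) from h)]
      split_ifs with hx
      · rw [sign_pos hp, sign_pos (hb.1 hx)]
      · rw [sign_neg (neg_neg_of_pos hp), sign_neg]
        exact lt_of_le_of_ne (not_lt.1 fun h => hx (hb.2 h)) (Ξ.wt_ne_zero x)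
    · rw [e.sum_comp (fun z => T.tree.flow (e x) z), WBPTree.sum_flow, ← T.wt_lab, he']
  have hG : IsFlowTree Ξ.wt G := ⟨F.isTree_iff.2 T.tree.isTree, _, hf⟩
  let π : Rotations G := fun v => ⟨(F.mapNeighborSet v).symm.permCongr (T.tree.next (F v)), by
    intro a b
    obtain ⟨k, hk⟩ := T.tree.next_cyclic (F v) (F.mapNeighborSet v a) (F.mapNeighborSet v b)
    refine ⟨k, ?_⟩
    have h1 : ((F.mapNeighborSet v).symm.permCongr (T.tree.next (F v))) ^ k =
        (F.mapNeighborSet v).symm.permCongr (T.tree.next (F v) ^ k) :=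
      (map_zpow (F.mapNeighborSet v).symm.permCongrHom (T.tree.next (F v)) k).symm
    rw [h1, Equiv.permCongr_apply, Equiv.symm_symm, hk, Equiv.symm_apply_apply]⟩
  refine ⟨⟨⟨G, hG⟩, π⟩, F, fun (v : S) => ?_, fun (v : S) (a : G.neighborSet v) => ?_, ?_,
    fun v => he' v⟩
  · rw [T.mem_black_iff]
    change 0 < Ξ.wt (T.lab (e v)) ↔ 0 < Ξ.wt v
    rw [he']
  · change F.mapNeighborSet v ((F.mapNeighborSet v).symm.permCongr (T.tree.next (F v)) a) = _
    rw [Equiv.permCongr_apply, Equiv.apply_symm_apply, Equiv.symm_symm]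
    rfl
  · rintro ⟨z, hz⟩
    induction z using Sym2.ind with
    | _ x y =>
      change T.tree.edgeWeight ⟨s(e x, e y), hz⟩ = |hG.flow x y|
      rw [IsFlow.unique hG.1 hG.isFlow_flow hf x y]
      exact (T.tree.abs_flow hz).symm

/-- The isomorphism classes of labeled trees are the plane flow trees on `S`. -/
noncomputable def Passport.IsFull.treesEquiv (hΞ : Ξ.IsFull) :
    PlaneFlowTree Ξ.wt ≃ Ξ.Trees :=
  Equiv.ofBijective (fun i => Quotient.mk (LWBPTree.setoid Ξ) (i.toLWBPTree hΞ))
    ⟨fun _ _ h => PlaneFlowTree.toLWBPTree_injective hΞ (Quotient.exact h), fun T => by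
      induction T using Quotient.ind with
      | _ T =>
        obtain ⟨i, hi⟩ := T.exists_isomorphic hΞ
        exact ⟨i, Quotient.sound hi⟩⟩

open Classical in
theorem card_planeFlowTree [DecidableEq S] (wt : S → ℝ) : Nat.card (PlaneFlowTree wt) =
    ∑ G with IsFlowTree wt G, ∏ v, ((G.neighborSet v).ncard - 1)! := by
  rw [Nat.card_sigma, Finset.sum_subtype (p := IsFlowTree wt) _ (by simp)]
  refine Finset.sum_congr rfl fun G _ => ?_
  rw [Nat.card_pi]
  exact Finset.prod_congr rfl fun v _ => card_cyclic_perm _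

end Quotient

/-! ### Kochetkov's formula -/

section Main

variable {S : Type u} [Fintype S] [DecidableEq S] {Ξ : Passport S}

/-- The exponential of the zero-sum part of `cyc`, as a sum over the partitions of the passport. -/
theorem setExp_smul_cyc_univ (hΞ : Ξ.IsFull) (z : ℚ) :
    SetSeries.setExp (z • SetSeries.cut Ξ.wt 0 SetSeries.cyc) Finset.univ =
      ∑ p ∈ Ξ.partitions, z ^ p.parts.card * (partitionX p : ℚ) := by
  classical
  have h1 : ∀ B : Finset S, B ≠ ∅ → (z • SetSeries.cut Ξ.wt 0 SetSeries.cyc) B =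
      if ∑ s ∈ B, (Ξ.mult s : ℝ) * Ξ.wt s = 0 then z * ((B.card - 1)! : ℚ) else 0 := by
    intro B hB
    have h2 : ∑ s ∈ B, (Ξ.mult s : ℝ) * Ξ.wt s = ∑ s ∈ B, Ξ.wt s :=
      Finset.sum_congr rfl fun s _ => by rw [hΞ s, Nat.cast_one, one_mul]
    rw [h2, SetSeries.smul_apply, SetSeries.cut_apply, SetSeries.wsign, SetSeries.cyc,
      if_neg (mt Finset.card_eq_zero.1 hB)]
    simp only [sign_eq_zero_iff, mul_ite, mul_zero]
  have h3 : ∑ p ∈ Ξ.partitions, z ^ p.parts.card * (partitionX p : ℚ) =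
      ∑ p : Finpartition (Finset.univ : Finset S),
        ∏ B ∈ p.parts, (z • SetSeries.cut Ξ.wt 0 SetSeries.cyc) B := by
    rw [Passport.partitions, Finset.sum_filter]
    refine Finset.sum_congr rfl fun p _ => ?_
    rw [Finset.prod_congr rfl fun B hB => h1 B (p.ne_bot hB)]
    split_ifs with hp
    · rw [Finset.prod_congr rfl fun B hB => if_pos (hp B hB), Finset.prod_mul_distrib,
        Finset.prod_const, partitionX, Nat.cast_prod]
    · push Not at hp
      obtain ⟨B, hB, hB0⟩ := hp
      exact (Finset.prod_eq_zero hB (if_neg hB0)).symm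
  rw [h3, SetSeries.setExp_apply]
  symm
  refine Finset.sum_bij (fun p _ => p.parts) ?_ ?_ ?_ ?_
  · intro p _
    exact SetSeries.mem_blockSets.2 ⟨p.bot_notMem, p.disjoint, p.sup_parts⟩
  · intro p _ q _ h
    exact Finpartition.ext h
  · intro P hP
    obtain ⟨h0, hd, hs⟩ := SetSeries.mem_blockSets.1 hP
    exact ⟨⟨P, Finset.supIndep_iff_pairwiseDisjoint.2 hd, hs, h0⟩, Finset.mem_univ _, rfl⟩
  · intro p _
    rfl

end Main

theorem theorem1p3 {S : Type u} [Fintype S] [DecidableEq S] (Ξ : Passport S) (hΞ : Ξ.IsFull) :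
    Finite Ξ.Trees ∧
    (Nat.card Ξ.Trees : ℚ) =
      ∑ p ∈ Ξ.partitions, (-1 : ℚ) ^ ((p.parts.card : ℤ) - 1) *
        ((Ξ.size : ℚ) - 1) ^ ((p.parts.card : ℤ) - 2) * (partitionX p : ℚ) ∧
    (Ξ.IsNonDecomposable → Nat.card Ξ.Trees = (Ξ.size - 2)!) := by
  classical
  have hsize : Ξ.size = Fintype.card S := by
    rw [Passport.size, Finset.sum_congr rfl fun s _ => hΞ s]
    simp
  have hnt := hΞ.nontrivial
  have hn : 2 ≤ Fintype.card S := Fintype.one_lt_card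
  have hn' : (2 : ℚ) ≤ Fintype.card S := by exact_mod_cast hn
  have hne : (Fintype.card S : ℚ) - 1 ≠ 0 := by linarith
  have hmain : (Nat.card Ξ.Trees : ℚ) =
      ∑ p ∈ Ξ.partitions, (-1 : ℚ) ^ ((p.parts.card : ℤ) - 1) *
        ((Ξ.size : ℚ) - 1) ^ ((p.parts.card : ℤ) - 2) * (partitionX p : ℚ) := by
    have h1 := SetSeries.rooted_tree_series_univ Ξ.wt_ne_zero hΞ.sum_wt hn
      (t := signedSeries Ξ.wt) fun σ _ => signedSeries_eq Ξ.wt σ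
    rw [signedSeries_univ Ξ.wt_ne_zero hΞ.sum_wt, setExp_smul_cyc_univ hΞ] at h1
    have h2 : (Nat.card Ξ.Trees : ℚ) = ∑ G with IsFlowTree Ξ.wt G,
        ∏ v, (((G.neighborSet v).ncard - 1)! : ℚ) := by
      rw [← Nat.card_congr hΞ.treesEquiv, card_planeFlowTree]
      simp only [Nat.cast_sum, Nat.cast_prod]
    rw [← h2] at h1
    rw [hsize]
    refine mul_left_cancel₀ (mul_ne_zero hne hne) ?_
    rw [show ((Fintype.card S : ℚ) - 1) * ((Fintype.card S : ℚ) - 1) * Nat.card Ξ.Trees =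
      -((1 - (Fintype.card S : ℚ)) * (((Fintype.card S : ℚ) - 1) * Nat.card Ξ.Trees)) by ring, h1,
      ← Finset.sum_neg_distrib, Finset.mul_sum]
    refine Finset.sum_congr rfl fun p _ => ?_
    rw [zpow_sub₀ (by norm_num), zpow_sub₀ hne, zpow_natCast, zpow_natCast,
      show (1 - (Fintype.card S : ℚ)) = (-1) * ((Fintype.card S : ℚ) - 1) by ring, mul_pow]
    have h3 : ((Fintype.card S : ℚ) - 1) ^ (2 : ℤ) =
      ((Fintype.card S : ℚ) - 1) * ((Fintype.card S : ℚ) - 1) := by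
        rw [zpow_two]
    rw [h3, zpow_one]
    field_simp
  refine ⟨Finite.of_equiv _ hΞ.treesEquiv, hmain, fun hd => ?_⟩
  have hne' : (Finset.univ : Finset S) ≠ ∅ := Finset.univ_nonempty.ne_empty
  let q : Finpartition (Finset.univ : Finset S) := Finpartition.indiscrete hne'
  have hq : Ξ.partitions = {q} := by
    ext p
    rw [Finset.mem_singleton]
    constructor
    · exact fun hp => Finpartition.ext (hd p hp)
    · rintro rfl
      rw [Passport.partitions, Finset.mem_filter]
      refine ⟨Finset.mem_univ _, fun B hB => ?_⟩
      rw [Finset.mem_singleton.1 hB]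
      exact Ξ.sum_eq_zero
  have hqp : q.parts = {Finset.univ} := rfl
  rw [hq, Finset.sum_singleton, partitionX, hqp, Finset.card_singleton, Finset.prod_singleton,
    hsize, Finset.card_univ] at hmain
  rw [hsize]
  have h4 : (Fintype.card S - 1)! = (Fintype.card S - 1) * (Fintype.card S - 2)! :=
    (Nat.mul_factorial_pred (by omega)).symm
  rw [h4, Nat.cast_mul, Nat.cast_sub (by omega)] at hmain
  norm_num at hmain
  rw [← mul_assoc, inv_mul_cancel₀ hne, one_mul] at hmain
  exact_mod_cast hmain
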